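/- Let $\mathcal P_n$ be the partition monoid, i.e. the monoid of all set partitions of $\{1,\dots,n\}\cup\{1',\dots,n'\}$ under the usual diagram multiplication: $x,y$ lie in the same block of $\alpha\beta$ if and only if they are connected in the graph obtained by stacking $\alpha$ on top of $\beta$, identifying the lower row of $\alpha$ with the upper row of $\beta$. Let $\alpha^*$ denote the partition obtained from $\alpha$ by interchanging $i$ and $i'$ for all $i$, and let $\operatorname{rank}(\alpha)$ be the number of blocks of $\alpha$ that contain both dashed and undashed elements. Let $\mathcal{PB}_n$ be the partial Brauer monoid (all blocks of size at most $2$), $\mathcal{PP}_n$ the planar partition monoid (all partitions that can be drawn without crossings inside the rectangle spanned by the two rows $1<\cdots<n$ and $1'<\cdots<n'$), and $\mathcal M_n=\mathcal{PP}_n\cap\mathcal{PB}_n$ the Motzkin monoid. For a finite semigroup $S$, let $\deg(S)$ be the least $d\ge 1$ such that $S$ embeds in the monoid $\mathcal T_d$ of all self-maps of $\{1,\dots,d\}$ (maps being composed from left to right). Proposition. Let $n\ge 2$, let $M$ be any of $\mathcal P_n$, $\mathcal{PB}_n$, $\mathcal{PP}_n$ or $\mathcal M_n$, and let $$Q=\{\varepsilon\in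 M:\varepsilon^2=\varepsilon=\varepsilon^*,\ \operatorname{rank}(\varepsilon)\le 2\}.$$ Then $\deg(M)\ge 1+|Q|$. Equivalently, every faithful right semigroup action $X\times M\to X$ of $M$ on a set $X$ satisfies $|X|\ge 1+|Q|$. -/

import Mathlib

/-- The partition monoid `𝒫ₙ` (as a type): set partitions, i.e. equivalence relations, of the set
`{1,…,n} ∪ {1',…,n'}`.  The upper vertex `i` is `Sum.inl i`, the lower vertex `i'` is `Sum.inr i`. -/
@[ext]
structure PartitionMonoid (n : ℕ) where
  /-- "belongs to the same block as" -/
  blocks : Setoid (Fin n ⊕ Fin n)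

namespace PartitionMonoid

variable {n : ℕ}

/-- `α.Rel x y`: the vertices `x` and `y` lie in the same block of `α`. -/
def Rel (α : PartitionMonoid n) (x y : Fin n ⊕ Fin n) : Prop := α.blocks x y

/-- Vertex set of a product graph: upper row `inl i`, middle row `inr (inl i)` (that is `i''`),
lower row `inr (inr i)`. -/
abbrev Vertex3 (n : ℕ) : Type := Fin n ⊕ (Fin n ⊕ Fin n)

/-- Vertices of `α` in the product graph `Π(α,β)`: `i ↦ i`, `i' ↦ i''`. -/
def up : Fin n ⊕ Fin n → Vertex3 n := Sum.elim Sum.inl (fun i => Sum.inr (Sum.inl i))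

/-- Vertices of `β` in the product graph `Π(α,β)`: `i ↦ i''`, `i' ↦ i'`. -/
def low : Fin n ⊕ Fin n → Vertex3 n := Sum.inr

/-- Vertices of `αβ` in the product graph `Π(α,β)`: `i ↦ i`, `i' ↦ i'`. -/
def outer : Fin n ⊕ Fin n → Vertex3 n := Sum.elim Sum.inl (fun i => Sum.inr (Sum.inr i))

/-- The edges of the product graph `Π(α,β)`: those of `α`, drawn between the upper and the middle
row, and those of `β`, drawn between the middle and the lower row. -/
inductive ProdEdge (α β : PartitionMonoid n) : Vertex3 n → Vertex3 n → Prop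
  | left (x y : Fin n ⊕ Fin n) : α.Rel x y → ProdEdge α β (up x) (up y)
  | right (x y : Fin n ⊕ Fin n) : β.Rel x y → ProdEdge α β (low x) (low y)

/-- `u` and `v` lie in the same connected component of the product graph `Π(α,β)`. -/
def ProdConn (α β : PartitionMonoid n) : Vertex3 n → Vertex3 n → Prop :=
  Relation.EqvGen (ProdEdge α β)

/-- The product `αβ`: two outer vertices are in the same block iff they are connected in
`Π(α,β)`. -/
instance : Mul (PartitionMonoid n) where
  mul α β := ⟨(Relation.EqvGen.setoid (ProdEdge α β)).comap outer⟩

/-- The identity partition, with blocks `{i, i'}`. -/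
instance : One (PartitionMonoid n) where
  one := ⟨Setoid.ker (Sum.elim (id : Fin n → Fin n) id)⟩

/-- `α*` interchanges dashed and undashed vertices. -/
instance : Star (PartitionMonoid n) where
  star α := ⟨α.blocks.comap Sum.swap⟩

/-- The rank: the number of transversals, i.e. blocks with both an upper and a lower vertex. -/
noncomputable def rank (α : PartitionMonoid n) : ℕ :=
  {B : Set (Fin n ⊕ Fin n) | B ∈ α.blocks.classes ∧
    (∃ i, Sum.inl i ∈ B) ∧ (∃ j, Sum.inr j ∈ B)}.ncard

/-- Every block has at most two elements. -/
def IsPartialBrauer (α : PartitionMonoid n) : Prop :=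
  ∀ B ∈ α.blocks.classes, B.ncard ≤ 2

/-- Position of a vertex on the boundary of the rectangle spanned by the two rows, traversed as
`1, …, n, n', …, 1'`. -/
def pos : Fin n ⊕ Fin n → ℕ := Sum.elim (fun i => i.val) (fun j => 2 * n - 1 - j.val)

/-- Planarity: the blocks can be drawn inside the rectangle without crossings, i.e. no two distinct
blocks interlace along the boundary of the rectangle. -/
def IsPlanar (α : PartitionMonoid n) : Prop :=
  ∀ a b c d : Fin n ⊕ Fin n, pos a < pos b → pos b < pos c → pos c < pos d →
    α.Rel a c → α.Rel b d → α.Rel a b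

/-! ### `𝒫ₙ` is a monoid -/

theorem Rel.refl (α : PartitionMonoid n) (x) : α.Rel x x := α.blocks.refl' x
theorem Rel.symm {α : PartitionMonoid n} {x y} (h : α.Rel x y) : α.Rel y x := α.blocks.symm' h
theorem Rel.trans {α : PartitionMonoid n} {x y z} (h : α.Rel x y) (h' : α.Rel y z) : α.Rel x z :=
  α.blocks.trans' h h'

theorem mul_rel (α β : PartitionMonoid n) (x y) :
    (α * β).Rel x y ↔ ProdConn α β (outer x) (outer y) := Iff.rfl

/-- A predicate, given by its upper part `p` and its lower part `q`, is constant on blocks. -/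
def Inv (α : PartitionMonoid n) (p q : Fin n → Prop) : Prop :=
  ∀ x y, α.Rel x y → (Sum.elim p q x ↔ Sum.elim p q y)

theorem eq_of_inv {α β : PartitionMonoid n} (h : ∀ p q, Inv α p q ↔ Inv β p q) : α = β := by
  have key : ∀ {α β : PartitionMonoid n}, (∀ p q, Inv α p q ↔ Inv β p q) →
      ∀ x y, β.Rel x y → α.Rel x y := by
    intro α β h x y hxy
    have h1 : Inv α (fun i => α.Rel x (Sum.inl i)) (fun i => α.Rel x (Sum.inr i)) := by
      rintro (u | u) (v | v) huv <;>
        exact ⟨fun h => h.trans huv, fun h => h.trans huv.symm⟩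
    have h2 := ((h _ _).1 h1) x y hxy
    have h3 : ∀ z, Sum.elim (fun i => α.Rel x (Sum.inl i)) (fun i => α.Rel x (Sum.inr i)) z
        ↔ α.Rel x z := by rintro (u | u) <;> rfl
    exact (h3 y).1 (h2.1 ((h3 x).2 (Rel.refl α x)))
  ext x y
  exact ⟨key (fun p q => (h p q).symm) x y, key h x y⟩

theorem inv_mul (α β : PartitionMonoid n) (p r : Fin n → Prop) :
    Inv (α * β) p r ↔ ∃ q, Inv α p q ∧ Inv β q r := by
  constructor
  · intro h
    let S : Vertex3 n → Prop := fun v => ∃ w, Sum.elim p r w ∧ ProdConn α β (outer w) v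
    have hS : ∀ u v, ProdEdge α β u v → (S u ↔ S v) := fun u v huv =>
      ⟨fun ⟨w, hw, c⟩ => ⟨w, hw, c.trans _ _ _ (.rel _ _ huv)⟩,
       fun ⟨w, hw, c⟩ => ⟨w, hw, c.trans _ _ _ (.symm _ _ (.rel _ _ huv))⟩⟩
    have ho : ∀ w, S (outer w) ↔ Sum.elim p r w := fun w =>
      ⟨fun ⟨w', hw, c⟩ => (h w' w c).1 hw, fun hw => ⟨w, hw, .refl _⟩⟩
    refine ⟨fun i => S (Sum.inr (Sum.inl i)), ?_, ?_⟩
    · intro x y hxy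
      have e : ∀ x, Sum.elim p (fun i => S (Sum.inr (Sum.inl i))) x ↔ S (up x) := by
        rintro (i | i)
        · exact (ho (Sum.inl i)).symm
        · rfl
      rw [e, e]; exact hS _ _ (.left _ _ hxy)
    · intro x y hxy
      have e : ∀ x, Sum.elim (fun i => S (Sum.inr (Sum.inl i))) r x ↔ S (low x) := by
        rintro (i | i)
        · rfl
        · exact (ho (Sum.inr i)).symm
      rw [e, e]; exact hS _ _ (.right _ _ hxy)
  · rintro ⟨q, hα, hβ⟩ x y hxy
    have main : ∀ u v, ProdConn α β u v →
        (Sum.elim p (Sum.elim q r) u ↔ Sum.elim p (Sum.elim q r) v) := by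
      intro u v huv
      induction huv with
      | rel u v h =>
        cases h with
        | left x y h => have := hα x y h; rcases x with x | x <;> rcases y with y | y <;> exact this
        | right x y h => exact hβ x y h
      | refl => rfl
      | symm _ _ _ ih => exact ih.symm
      | trans _ _ _ _ _ ih1 ih2 => exact ih1.trans ih2
    have := main _ _ hxy
    rcases x with x | x <;> rcases y with y | y <;> exact this

theorem inv_one (p q : Fin n → Prop) : Inv (1 : PartitionMonoid n) p q ↔ p = q := by
  constructor
  · intro h
    funext i
    exact propext (h (Sum.inl i) (Sum.inr i) rfl)
  · rintro rfl (x | x) (y | y) h <;>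
    · have h' : x = y := h
      subst h'; rfl

instance : Monoid (PartitionMonoid n) where
  mul_assoc α β γ := eq_of_inv fun p q => by
    simp only [inv_mul]
    constructor
    · rintro ⟨s, ⟨t, h1, h2⟩, h3⟩; exact ⟨t, h1, s, h2, h3⟩
    · rintro ⟨t, h1, s, h2, h3⟩; exact ⟨s, ⟨t, h1, h2⟩, h3⟩
  one_mul α := eq_of_inv fun p q => by simp [inv_mul, inv_one]
  mul_one α := eq_of_inv fun p q => by simp [inv_mul, inv_one]

instance : Finite (PartitionMonoid n) :=
  Finite.of_injective (fun α => α.Rel) fun α β h => by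
    ext x y; exact iff_of_eq (congrFun (congrFun h x) y)

/-! ### Planar partitions are closed under products -/

theorem pos_injective : Function.Injective (pos : Fin n ⊕ Fin n → ℕ) := by
  rintro (x | x) (y | y) h <;> simp only [pos, Sum.elim_inl, Sum.elim_inr] at h
  · congr 1; ext; exact h
  · omega
  · omega
  · congr 1; ext; omega

/-- The parity, with weights `f`, of the vertices that come after `v`. -/
def after (f : Fin n ⊕ Fin n → ZMod 2) (v : Fin n ⊕ Fin n) : ZMod 2 :=
  ∑ u, f u * (if pos v < pos u then 1 else 0)

/-- Mod 2 boundaries of edges inside `D`, seen from the vertices outside `D`. -/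
structure GoodChain (α : PartitionMonoid n) (D : Fin n ⊕ Fin n → Prop)
    (f : Fin n ⊕ Fin n → ZMod 2) : Prop where
  supp : ∀ x, ¬ D x → f x = 0
  sum : ∑ x, f x = 0
  inv : ∀ v w, ¬ D v → α.Rel v w → after f v = after f w

theorem GoodChain.zero (α : PartitionMonoid n) (D) : GoodChain α D 0 :=
  ⟨fun _ _ => rfl, by simp, fun _ _ _ _ => by simp [after]⟩

theorem GoodChain.add {α : PartitionMonoid n} {D} {f g} (hf : GoodChain α D f)
    (hg : GoodChain α D g) : GoodChain α D (f + g) := by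
  refine ⟨fun x hx => by simp [hf.supp x hx, hg.supp x hx], ?_, fun v w hv h => ?_⟩
  · simp [Finset.sum_add_distrib, hf.sum, hg.sum]
  · have h1 := hf.inv v w hv h
    have h2 := hg.inv v w hv h
    simp only [after] at h1 h2 ⊢
    simp only [Pi.add_apply, add_mul, Finset.sum_add_distrib, h1, h2]

theorem noncrossing_parity {α : PartitionMonoid n} (hα : IsPlanar α) {x y v w}
    (hxy : α.Rel x y) (hvw : α.Rel v w) (hn : ¬ α.Rel x v) :
    ((if pos v < pos x then 1 else 0) + (if pos v < pos y then 1 else 0) : ZMod 2) =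
    (if pos w < pos x then 1 else 0) + (if pos w < pos y then 1 else 0) := by
  have ne : ∀ a b, α.Rel x a → α.Rel v b → pos a ≠ pos b := by
    intro a b ha hb h
    have := pos_injective h
    subst this
    exact hn (ha.trans hb.symm)
  have n1 := ne x v (.refl _ _) (.refl _ _)
  have n2 := ne x w (.refl _ _) hvw
  have n3 := ne y v hxy (.refl _ _)
  have n4 := ne y w hxy hvw
  have hc : ∀ a b c d, α.Rel x a → α.Rel v b → α.Rel x c → α.Rel v d →
      ¬ (pos a < pos b ∧ pos b < pos c ∧ pos c < pos d) := by
    rintro a b c d ha hb hc hd ⟨h1, h2, h3⟩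
    exact hn (ha.trans ((hα a b c d h1 h2 h3 (ha.symm.trans hc) (hb.symm.trans hd)).trans hb.symm))
  have hc' : ∀ a b c d, α.Rel x a → α.Rel v b → α.Rel x c → α.Rel v d →
      ¬ (pos b < pos a ∧ pos a < pos d ∧ pos d < pos c) := by
    rintro a b c d ha hb hc hd ⟨h1, h2, h3⟩
    exact hn (ha.trans ((hα b a d c h1 h2 h3 (hb.symm.trans hd) (ha.symm.trans hc)).symm.trans
      hb.symm))
  have rx := Rel.refl α x
  have rv := Rel.refl α v
  have a1 := hc x v y w rx rv hxy hvw
  have a2 := hc x w y v rx hvw hxy rv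
  have a3 := hc y v x w hxy rv rx hvw
  have a4 := hc y w x v hxy hvw rx rv
  have b1 := hc' x v y w rx rv hxy hvw
  have b2 := hc' x w y v rx hvw hxy rv
  have b3 := hc' y v x w hxy rv rx hvw
  have b4 := hc' y w x v hxy hvw rx rv
  have two : (1 + 1 : ZMod 2) = 0 := by decide
  split_ifs <;> first | rfl | (simp [two]; done) | (exfalso; omega)

theorem GoodChain.edge {α : PartitionMonoid n} (hα : IsPlanar α) {D : Fin n ⊕ Fin n → Prop}
    (hD : ∀ u v, α.Rel u v → D u → D v) {x y} (hx : D x) (hxy : α.Rel x y) :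
    GoodChain α D (Pi.single x 1 + Pi.single y 1) := by
  have two : (1 + 1 : ZMod 2) = 0 := by decide
  refine ⟨fun z hz => ?_, ?_, fun v w hv h => ?_⟩
  · have h1 : z ≠ x := by rintro rfl; exact hz hx
    have h2 : z ≠ y := by rintro rfl; exact hz (hD _ _ hxy hx)
    simp [h1, h2]
  · simp [Finset.sum_add_distrib, two]
  · have e : ∀ v, after (Pi.single x 1 + Pi.single y 1) v =
        (if pos v < pos x then 1 else 0) + (if pos v < pos y then 1 else 0) := by
      intro v
      simp only [after, Pi.add_apply, add_mul, Finset.sum_add_distrib]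
      congr 1 <;>
      · rw [Finset.sum_eq_single_of_mem _ (Finset.mem_univ _)
          (fun b _ hb => by rw [Pi.single_eq_of_ne hb, zero_mul])]
        simp
    rw [e, e]
    exact noncrossing_parity hα hxy h (fun hxv => hv (hD _ _ hxv hx))

theorem planar_mul {α β : PartitionMonoid n} (hα : IsPlanar α) (hβ : IsPlanar β) :
    IsPlanar (α * β) := by
  have two : ∀ z : ZMod 2, z + z = 0 := by decide
  intro a b c d hab hbc hcd hac hbd
  by_contra hn
  rw [mul_rel] at hac hbd hn
  let D : Vertex3 n → Prop := ProdConn α β (outer b)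
  have hDi : ∀ u v, ProdEdge α β u v → D u → D v := fun u v h hu => hu.trans _ _ _ (.rel _ _ h)
  have hDα : ∀ u v, α.Rel u v → (D ∘ up) u → (D ∘ up) v := fun u v h => hDi _ _ (.left _ _ h)
  have hDβ : ∀ u v, β.Rel u v → (D ∘ low) u → (D ∘ low) v := fun u v h => hDi _ _ (.right _ _ h)
  -- a mod 2 chain in `D` with boundary `b + d`
  have chain : ∀ x y, ProdConn α β x y → D x → ∃ f g, GoodChain α (D ∘ up) f ∧
      GoodChain β (D ∘ low) g ∧
      ∀ z, Sum.elim (fun i => f (Sum.inl i))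
        (Sum.elim (fun i => f (Sum.inr i) + g (Sum.inl i)) (fun i => g (Sum.inr i))) z =
        (Pi.single x 1 + Pi.single y 1 : Vertex3 n → ZMod 2) z := by
    intro x y hxy
    induction hxy with
    | rel x y h =>
      intro hx
      cases h with
      | left x y h =>
        refine ⟨_, 0, .edge hα hDα hx h, .zero _ _, ?_⟩
        rintro (i | i | i) <;> rcases x with x | x <;> rcases y with y | y <;>
          simp [up, Pi.single_apply]
      | right x y h =>
        refine ⟨0, _, .zero _ _, .edge hβ hDβ hx h, ?_⟩
        rintro (i | i | i) <;> rcases x with x | x <;> rcases y with y | y <;>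
          simp [low, Pi.single_apply]
    | refl x =>
      intro _
      refine ⟨0, 0, .zero _ _, .zero _ _, ?_⟩
      intro z
      rw [Pi.add_apply, two]
      rcases z with i | i | i <;> simp
    | symm x y h ih =>
      intro hy
      obtain ⟨f, g, hf, hg, e⟩ := ih (hy.trans _ _ _ (.symm _ _ h))
      exact ⟨f, g, hf, hg, fun z => by rw [e z, add_comm]⟩
    | trans x y z h1 h2 ih1 ih2 =>
      intro hx
      obtain ⟨f, g, hf, hg, e⟩ := ih1 hx
      obtain ⟨f', g', hf', hg', e'⟩ := ih2 (hx.trans _ _ _ h1)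
      refine ⟨f + f', g + g', hf.add hf', hg.add hg', fun w => ?_⟩
      have h3 : (Pi.single x 1 + Pi.single z 1 : Vertex3 n → ZMod 2) w =
          (Pi.single x 1 + Pi.single y 1 : Vertex3 n → ZMod 2) w +
          (Pi.single y 1 + Pi.single z 1 : Vertex3 n → ZMod 2) w := by
        simp only [Pi.add_apply]
        linear_combination - two ((Pi.single y 1 : Vertex3 n → ZMod 2) w)
      rw [h3, ← e, ← e']
      rcases w with i | i | i <;> simp
      all_goals ring
  obtain ⟨f, g, hf, hg, e⟩ := chain _ _ hbd (.refl _)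
  have out_mid : ∀ (x : Fin n ⊕ Fin n) i, outer x ≠ Sum.inr (Sum.inl i) := by
    rintro (x | x) i <;> simp [outer]
  have hmid : ∀ i, f (Sum.inr i) = g (Sum.inl i) := by
    intro i
    have := e (Sum.inr (Sum.inl i))
    simp only [Sum.elim_inr, Sum.elim_inl, Pi.add_apply,
      Pi.single_eq_of_ne (out_mid _ i).symm, add_zero] at this
    linear_combination this - two (g (Sum.inl i))
  -- the weight on outer vertices
  let k : Fin n ⊕ Fin n → ZMod 2 := Pi.single b 1 + Pi.single d 1
  have hk1 : ∀ i, f (Sum.inl i) = k (Sum.inl i) := by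
    intro i
    have := e (Sum.inl i)
    simp only [Sum.elim_inl] at this
    rw [this]
    rcases b with b | b <;> rcases d with d | d <;> simp [k, outer, Pi.single_apply]
  have hk2 : ∀ i, g (Sum.inr i) = k (Sum.inr i) := by
    intro i
    have := e (Sum.inr (Sum.inr i))
    simp only [Sum.elim_inr] at this
    rw [this]
    rcases b with b | b <;> rcases d with d | d <;> simp [k, outer, Pi.single_apply]
  have sf := hf.sum
  have sg := hg.sum
  rw [Fintype.sum_sum_type] at sf sg
  simp only [hk1, hk2, ← hmid] at sf sg
  have pu : ∀ i j : Fin n, (pos (Sum.inl i : Fin n ⊕ Fin n) < pos (Sum.inl j : Fin n ⊕ Fin n)) ↔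
    i < j := fun i j => by simp [pos]
  have pul : ∀ i j : Fin n, (pos (Sum.inl i : Fin n ⊕ Fin n) < pos (Sum.inr j : Fin n ⊕ Fin n)) ↔
    True := fun i j => by simp [pos]; omega
  have plu : ∀ i j : Fin n, (pos (Sum.inr i : Fin n ⊕ Fin n) < pos (Sum.inl j : Fin n ⊕ Fin n)) ↔
    False := fun i j => by simp [pos]; omega
  have pl : ∀ i j : Fin n, (pos (Sum.inr i : Fin n ⊕ Fin n) < pos (Sum.inr j : Fin n ⊕ Fin n)) ↔
    j < i := fun i j => by simp only [pos, Sum.elim_inr, Fin.lt_def]; omega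
  -- the potential
  let H : Vertex3 n → ZMod 2 := Sum.elim (fun i => after f (Sum.inl i)) (after g)
  have Hup : ∀ x, ¬ D (up x) → H (up x) = after f x := by
    rintro (i | i) hx
    · rfl
    · have h0 : f (Sum.inr i) = 0 := hf.supp (Sum.inr i) hx
      change after g (Sum.inl i) = after f (Sum.inr i)
      simp only [after, Fintype.sum_sum_type, pu, pul, plu, pl, if_true, if_false, mul_one,
        mul_zero, Finset.sum_const_zero, zero_add, ← hmid, hk2]
      have h1 : ∑ x : Fin n, f (Sum.inr x) * (if i < x then 1 else 0) +
          ∑ x : Fin n, f (Sum.inr x) * (if x < i then 1 else 0) = ∑ x : Fin n, f (Sum.inr x) := by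
        rw [← Finset.sum_add_distrib]
        refine Finset.sum_congr rfl fun x _ => ?_
        rcases lt_trichotomy i x with h | rfl | h
        · simp [h, h.not_gt]
        · simp [h0]
        · simp [h, h.not_gt]
      linear_combination h1 + sg - two (∑ x : Fin n, f (Sum.inr x) * (if x < i then 1 else 0))
  have Hconst : ∀ u v, ProdConn α β u v → ¬ D u → H u = H v := by
    intro u v huv
    induction huv with
    | rel u v h =>
      intro hu
      have hv : ¬ D v := fun hv => hu (hv.trans _ _ _ (.symm _ _ (.rel _ _ h)))
      cases h with
      | left x y h => rw [Hup x hu, Hup y hv]; exact hf.inv _ _ hu h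
      | right x y h => exact hg.inv _ _ hu h
    | refl => intro _; rfl
    | symm u v h ih => intro hv; exact (ih fun hu => hv (hu.trans _ _ _ h)).symm
    | trans u v w h1 h2 ih1 ih2 =>
      intro hu
      exact (ih1 hu).trans (ih2 fun hv => hu (hv.trans _ _ _ (.symm _ _ h1)))
  have Hout : ∀ x, H (outer x) = after k x := by
    rintro (i | i)
    · change after f (Sum.inl i) = after k (Sum.inl i)
      simp only [after, Fintype.sum_sum_type, pu, pul, if_true, mul_one, hk1]
      linear_combination sg - two (∑ x : Fin n, k (Sum.inr x))
    · change after g (Sum.inr i) = after k (Sum.inr i)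
      simp only [after, Fintype.sum_sum_type, plu, pl, if_false, mul_zero, hk2]
  have hDa : ¬ D (outer a) := fun h => hn (.symm _ _ h)
  have fin := Hconst _ _ hac hDa
  rw [Hout, Hout] at fin
  have ek : ∀ v, after k v =
      (if pos v < pos b then 1 else 0) + (if pos v < pos d then 1 else 0) := by
    intro v
    simp only [after, k, Pi.add_apply, add_mul, Finset.sum_add_distrib]
    congr 1 <;>
    · rw [Finset.sum_eq_single_of_mem _ (Finset.mem_univ _)
        (fun b _ hb => by rw [Pi.single_eq_of_ne hb, zero_mul])]
      simp
  rw [ek, ek, if_pos hab, if_pos (by omega), if_neg (by omega), if_pos hcd] at fin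
  revert fin
  decide

theorem planar_one : IsPlanar (1 : PartitionMonoid n) := by
  intro a b c d hab hbc hcd hac hbd
  rcases a with a | a <;> rcases b with b | b <;> rcases c with c | c <;> rcases d with d | d <;>
  · have h1 : a = c := hac
    have h2 : b = d := hbd
    subst h1 h2
    simp only [pos, Sum.elim_inl, Sum.elim_inr] at hab hbc hcd
    omega

/-! ### Partial Brauer partitions are closed under products -/

theorem isPartialBrauer_iff (α : PartitionMonoid n) :
    IsPartialBrauer α ↔ ∀ x y z, α.Rel x y → α.Rel x z → x = y ∨ x = z ∨ y = z := by
  constructor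
  · intro h x y z hxy hxz
    by_contra! hn
    have h1 := h {w | α.blocks w x} (α.blocks.mem_classes x)
    have h2 : ({x, y, z} : Set (Fin n ⊕ Fin n)) ⊆ {w | α.blocks w x} := by
      rintro w (rfl | rfl | rfl)
      · exact Rel.refl α _
      · exact hxy.symm
      · exact hxz.symm
    have h3 := Set.ncard_le_ncard h2 (Set.toFinite _)
    rw [Set.ncard_eq_three.2 ⟨x, y, z, hn.1, hn.2.1, hn.2.2, rfl⟩] at h3
    omega
  · rintro h B ⟨x, rfl⟩
    by_contra! hB
    obtain ⟨a, b, c, ha, hb, hc, h1, h2, h3⟩ := (Set.two_lt_ncard_iff (Set.toFinite _)).1 hB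
    have hab : α.Rel a b := Rel.trans (α := α) ha (Rel.symm (α := α) hb)
    have hac : α.Rel a c := Rel.trans (α := α) ha (Rel.symm (α := α) hc)
    rcases h a b c hab hac with h | h | h
    exacts [h1 h, h2 h, h3 h]

theorem partialBrauer_one : IsPartialBrauer (1 : PartitionMonoid n) := by
  rw [isPartialBrauer_iff]
  rintro (x | x) (y | y) (z | z) hxy hxz <;>
  · have h1 : x = y := hxy
    have h2 : x = z := hxz
    subst h1 h2
    simp

theorem up_inj : Function.Injective (up : _ → Vertex3 n) := by
  rintro (x | x) (y | y) h <;> simp_all [up]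

theorem outer_inj : Function.Injective (outer : _ → Vertex3 n) := by
  rintro (x | x) (y | y) h <;> simp_all [outer]

theorem partialBrauer_mul {α β : PartitionMonoid n} (hα : IsPartialBrauer α)
    (hβ : IsPartialBrauer β) : IsPartialBrauer (α * β) := by
  classical
  rw [isPartialBrauer_iff] at *
  intro a b c hab hac
  by_contra! hn
  have sy : ∀ u v, ProdEdge α β u v → ProdEdge α β v u := by
    rintro _ _ (⟨x, y, h⟩ | ⟨x, y, h⟩)
    exacts [.left _ _ h.symm, .right _ _ h.symm]
  let G : SimpleGraph (Vertex3 n) :=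
    { Adj := fun u v => u ≠ v ∧ ProdEdge α β u v
      symm := ⟨fun u v h => ⟨h.1.symm, sy _ _ h.2⟩⟩
      loopless := ⟨fun u h => h.1 rfl⟩ }
  have hreach : ∀ u v, ProdConn α β u v → G.Reachable u v := by
    intro u v h
    induction h with
    | rel u v h =>
      by_cases huv : u = v
      · rw [huv]
      · exact SimpleGraph.Adj.reachable (G := G) ⟨huv, h⟩
    | refl => rfl
    | symm _ _ _ ih => exact ih.symm
    | trans _ _ _ _ _ ih1 ih2 => exact ih1.trans ih2
  have low_inj : Function.Injective (low : _ → Vertex3 n) := Sum.inr_injective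
  let L : Vertex3 n → Vertex3 n → Prop := fun u v => ∃ x y, α.Rel x y ∧ up x = u ∧ up y = v
  let R : Vertex3 n → Vertex3 n → Prop := fun u v => ∃ x y, β.Rel x y ∧ low x = u ∧ low y = v
  have hLR : ∀ u v, G.Adj u v → L u v ∨ R u v := by
    rintro u v ⟨_, ⟨x, y, h⟩ | ⟨x, y, h⟩⟩
    exacts [.inl ⟨x, y, h, rfl, rfl⟩, .inr ⟨x, y, h, rfl, rfl⟩]
  have hL : ∀ u v w, u ≠ v → u ≠ w → L u v → L u w → v = w := by
    rintro _ _ _ h1 h2 ⟨x, y, h, rfl, rfl⟩ ⟨x', z, h', hx, rfl⟩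
    obtain rfl := up_inj hx
    rcases hα _ _ _ h h' with e | e | e
    exacts [absurd (congrArg up e) h1, absurd (congrArg up e) h2, congrArg up e]
  have hR : ∀ u v w, u ≠ v → u ≠ w → R u v → R u w → v = w := by
    rintro _ _ _ h1 h2 ⟨x, y, h, rfl, rfl⟩ ⟨x', z, h', hx, rfl⟩
    obtain rfl := low_inj hx
    rcases hβ _ _ _ h h' with e | e | e
    exacts [absurd (congrArg low e) h1, absurd (congrArg low e) h2, congrArg low e]
  let C := G.connectedComponentMk (outer a)
  have conn : C.toSimpleGraph.Connected := C.connected_toSimpleGraph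
  have deg2 : ∀ v, C.toSimpleGraph.degree v ≤ 2 := by
    intro v
    rw [← SimpleGraph.card_neighborFinset_eq_degree, ← Fintype.card_bool]
    refine Finset.card_le_card_of_injOn (fun u => decide (L v.1 u.1))
      (fun _ _ => Finset.mem_coe.2 (Finset.mem_univ _)) ?_
    intro u hu w hw h
    have hu0 : C.toSimpleGraph.Adj v u := by simpa using hu
    have hu' : G.Adj v.1 u.1 := hu0
    have hw0 : C.toSimpleGraph.Adj v w := by simpa using hw
    have hw' : G.Adj v.1 w.1 := hw0
    have h' : L v.1 u.1 ↔ L v.1 w.1 := by simpa using h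
    apply Subtype.ext
    by_cases hl : L v.1 u.1
    · exact hL _ _ _ hu'.1 hw'.1 hl (h'.1 hl)
    · exact hR _ _ _ hu'.1 hw'.1 ((hLR _ _ hu').resolve_left hl)
        ((hLR _ _ hw').resolve_left fun h => hl (h'.2 h))
  have deg1 : ∀ v x, v.1 = outer x → C.toSimpleGraph.degree v ≤ 1 := by
    intro v x hv
    rw [← SimpleGraph.card_neighborFinset_eq_degree, Finset.card_le_one]
    intro u hu w hw
    have hu0 : C.toSimpleGraph.Adj v u := by simpa using hu
    have hu' : G.Adj v.1 u.1 := hu0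
    have hw0 : C.toSimpleGraph.Adj v w := by simpa using hw
    have hw' : G.Adj v.1 w.1 := hw0
    apply Subtype.ext
    rcases x with i | i
    · have nR : ∀ z, ¬ R v.1 z := by
        rintro z ⟨x, y, h, e, _⟩
        rw [hv] at e
        simp [low, outer] at e
      exact hL _ _ _ hu'.1 hw'.1 ((hLR _ _ hu').resolve_right (nR _))
        ((hLR _ _ hw').resolve_right (nR _))
    · have nL : ∀ z, ¬ L v.1 z := by
        rintro z ⟨x, y, h, e, _⟩
        rw [hv] at e
        rcases x with x | x <;> simp [up, outer] at e
      exact hR _ _ _ hu'.1 hw'.1 ((hLR _ _ hu').resolve_left (nL _))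
        ((hLR _ _ hw').resolve_left (nL _))
  let A : C := ⟨outer a, rfl⟩
  let B : C := ⟨outer b, SimpleGraph.ConnectedComponent.sound (hreach _ _ hab).symm⟩
  let E : C := ⟨outer c, SimpleGraph.ConnectedComponent.sound (hreach _ _ hac).symm⟩
  have nAB : A ≠ B := fun h => hn.1 (outer_inj (congrArg Subtype.val h))
  have nAE : A ≠ E := fun h => hn.2.1 (outer_inj (congrArg Subtype.val h))
  have nBE : B ≠ E := fun h => hn.2.2 (outer_inj (congrArg Subtype.val h))
  have h1 := conn.card_vert_le_card_edgeSet_add_one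
  have h2 := C.toSimpleGraph.sum_degrees_eq_twice_card_edges
  have h3 : ∑ v, (C.toSimpleGraph.degree v + if v ∈ ({A, B, E} : Finset C) then 1 else 0) ≤
      ∑ _v : C, 2 := by
    refine Finset.sum_le_sum fun v _ => ?_
    split_ifs with h
    · have : C.toSimpleGraph.degree v ≤ 1 := by
        simp only [Finset.mem_insert, Finset.mem_singleton] at h
        rcases h with rfl | rfl | rfl
        exacts [deg1 _ a rfl, deg1 _ b rfl, deg1 _ c rfl]
      omega
    · exact deg2 v
  have h4 : ({A, B, E} : Finset C).card = 3 := Finset.card_eq_three.2 ⟨A, B, E, nAB, nAE, nBE, rfl⟩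
  rw [Finset.sum_add_distrib, h2, Finset.sum_ite_mem, Finset.univ_inter, Finset.sum_const,
    Finset.sum_const, h4, Finset.card_univ] at h3
  rw [Nat.card_eq_fintype_card, Nat.card_eq_fintype_card, ← SimpleGraph.edgeFinset_card] at h1
  simp only [smul_eq_mul] at h3
  omega

/-! ### The submonoids, and projections -/

/-- The partial Brauer monoid `𝒫ℬₙ`. -/
def partialBrauer (n : ℕ) : Submonoid (PartitionMonoid n) where
  carrier := {α | IsPartialBrauer α}
  mul_mem' := partialBrauer_mul
  one_mem' := partialBrauer_one

/-- The planar partition monoid `𝒫𝒫ₙ`. -/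
def planar (n : ℕ) : Submonoid (PartitionMonoid n) where
  carrier := {α | IsPlanar α}
  mul_mem' := planar_mul
  one_mem' := planar_one

/-- The Motzkin monoid `ℳₙ = 𝒫𝒫ₙ ∩ 𝒫ℬₙ`. -/
def motzkin (n : ℕ) : Submonoid (PartitionMonoid n) := planar n ⊓ partialBrauer n

/-- The projections of the submonoid `M` of rank at most `2`:
`Q(M) = {ε ∈ M | ε² = ε = ε*, rank ε ≤ 2}`. -/
def lowRankProjections (M : Submonoid (PartitionMonoid n)) : Set (PartitionMonoid n) :=
  {ε | ε ∈ M ∧ ε * ε = ε ∧ star ε = ε ∧ ε.rank ≤ 2}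

end PartitionMonoid

/-- A (right) action of a semigroup `S` on a set `X`: a map `μ : X × S → X` with
`μ(μ(x,a),b) = μ(x,ab)`.  Even for a monoid, the identity need not act trivially. -/
structure SemigroupRightAction (S : Type*) [Semigroup S] (X : Type*) where
  /-- the map `X × S → X` -/
  act : X → S → X
  act_act : ∀ x a b, act (act x a) b = act x (a * b)

/-- The action is faithful: the representation `a ↦ (x ↦ μ(x,a))` is injective. -/
def SemigroupRightAction.Faithful {S : Type*} [Semigroup S] {X : Type*}
    (μ : SemigroupRightAction S X) : Prop :=
  ∀ a b : S, (∀ x, μ.act x a = μ.act x b) → a = b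

/-- The minimum transformation degree of a semigroup `S`: the least `d ≥ 1` such that `S` embeds in
the full transformation monoid of `{1,…,d}`, composed from left to right (whence the opposite of
`Function.End`). -/
noncomputable def minTransformationDegree (S : Type*) [Semigroup S] : ℕ :=
  sInf {d : ℕ | 1 ≤ d ∧ ∃ φ : S →ₙ* (Function.End (Fin d))ᵐᵒᵖ, Function.Injective φ}

namespace PartitionMonoid

variable {n : ℕ}

/-! ### Partitions generated by pairs -/

/-! A partition is determined by the predicates constant on its blocks (`eq_of_inv`), and products
become relational composition (`inv_mul`). Every product below is computed this way: two outer
vertices are connected iff no invariant predicate tells them apart.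

Put `o = 0` and `o' = 1` in `Fin n`; this is where `2 ≤ n` enters. A faithful action has points `x`,
`w`, `u` whose images under `discrete` differ from those under an upper pair, a vertical pair and a
lower pair respectively. A projection `ε` of rank 2, 1 or 0 gets a point `x·λε`, `w·λε` or `u·λε`,
where `λ` ties `o` and `o'` (or `o` alone, or nothing) to the transversal blocks of `ε`. Multiplying
further by a Motzkin element `β` collapses `λεβ` to the nontrivial pair or to `discrete`, according
to whether `β` closes a certain path through `ε`. The point therefore records which `β` close it,
and this determines `ε` (`IsRankTwo.eq_of_joins_iff`, `IsRankOne.eq_of_reaches_iff`,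
`IsFrame.eq_of_rankZero`). All probes lie in the Motzkin monoid, so one argument serves all four
monoids.

Points of different ranks are told apart by `UpperConst`, which fails exactly in rank two, and
`PairConst`, which fails in rank one but holds in rank zero. The additional point `z` is an image of
`x` under an element with only singletons below. Upper pairs fix it, whereas they send every
rank-zero point to `u·discrete ≠ z`. -/

theorem inv_class (α : PartitionMonoid n) (x) :
    Inv α (fun i => α.Rel x (Sum.inl i)) (fun i => α.Rel x (Sum.inr i)) := by
  rintro (u | u) (v | v) huv <;>
    exact ⟨fun h => h.trans huv, fun h => h.trans huv.symm⟩

theorem Inv.or {α : PartitionMonoid n} {p q p' q'} (h : Inv α p q) (h' : Inv α p' q') :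
    Inv α (fun i => p i ∨ p' i) (fun i => q i ∨ q' i) := by
  rintro (u | u) (v | v) huv <;> exact or_congr (h _ _ huv) (h' _ _ huv)

/-- Two values, chosen according to an invariant predicate. -/
theorem Inv.choice {α : PartitionMonoid n} {p q} (h : Inv α p q) (a b : Prop) :
    Inv α (fun i => p i ∧ a ∨ ¬ p i ∧ b) (fun i => q i ∧ a ∨ ¬ q i ∧ b) := by
  rintro (u | u) (v | v) huv <;> have := h _ _ huv <;>
    simp only [Sum.elim_inl, Sum.elim_inr] at this ⊢ <;> rw [this]

theorem inv_const (α : PartitionMonoid n) (a : Prop) : Inv α (fun _ => a) (fun _ => a) := by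
  rintro (u | u) (v | v) _ <;> rfl

/-- The finest partition in which the two vertices of each pair in `S` lie in the same block. -/
def ofPairs (S : Set ((Fin n ⊕ Fin n) × (Fin n ⊕ Fin n))) : PartitionMonoid n :=
  ⟨Relation.EqvGen.setoid fun x y => (x, y) ∈ S⟩

theorem inv_ofPairs (S : Set ((Fin n ⊕ Fin n) × (Fin n ⊕ Fin n))) (p q : Fin n → Prop) :
    Inv (ofPairs S) p q ↔ ∀ e ∈ S, (Sum.elim p q e.1 ↔ Sum.elim p q e.2) := by
  refine ⟨fun h e he => h _ _ (.rel _ _ he), fun h x y hxy => ?_⟩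
  replace hxy : Relation.EqvGen (fun x y => (x, y) ∈ S) x y := hxy
  induction hxy with
  | rel x y hxy => exact h _ hxy
  | refl => rfl
  | symm _ _ _ ih => exact ih.symm
  | trans _ _ _ _ _ ih1 ih2 => exact ih1.trans ih2

/-- The position of `z` is strictly between those of `x` and `y`. -/
def Between (x y z : Fin n ⊕ Fin n) : Prop :=
  (pos x < pos z ∧ pos z < pos y) ∨ (pos y < pos z ∧ pos z < pos x)

/-- The pairs `e` and `f` are disjoint and do not cross. -/
def Apart (e f : (Fin n ⊕ Fin n) × (Fin n ⊕ Fin n)) : Prop :=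
  (e.1 ≠ f.1 ∧ e.1 ≠ f.2 ∧ e.2 ≠ f.1 ∧ e.2 ≠ f.2) ∧ (Between e.1 e.2 f.1 ↔ Between e.1 e.2 f.2)

/-- Distinct pairs of `S` share no vertex, so transitivity adds nothing to the reflexive symmetric
closure. -/
theorem ofPairs_rel {S : Set ((Fin n ⊕ Fin n) × (Fin n ⊕ Fin n))}
    (hS : ∀ e ∈ S, ∀ f ∈ S, e = f ∨ Apart e f) {x y} (h : (ofPairs S).Rel x y) :
    x = y ∨ (x, y) ∈ S ∨ (y, x) ∈ S := by
  replace h : Relation.EqvGen (fun x y => (x, y) ∈ S) x y := h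
  induction h with
  | rel x y h => exact .inr (.inl h)
  | refl => exact .inl rfl
  | symm _ _ _ ih => tauto
  | trans x y z _ _ ih1 ih2 =>
    rcases ih1 with rfl | h1 | h1
    · exact ih2
    all_goals
      rcases ih2 with rfl | h2 | h2
      · tauto
      all_goals
        rcases hS _ h1 _ h2 with h | h
        · simp only [Prod.mk.injEq] at h
          grind
        · have := h.1
          simp at this

/-- By `ofPairs_rel`, interlacing blocks would come from two crossing pairs of `S`, and a block with
three elements from two distinct pairs with a common vertex. -/
theorem ofPairs_mem_motzkin {S : Set ((Fin n ⊕ Fin n) × (Fin n ⊕ Fin n))}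
    (hS : ∀ e ∈ S, ∀ f ∈ S, e = f ∨ Apart e f) : ofPairs S ∈ motzkin n := by
  constructor
  · intro a b c d hab hbc hcd hac hbd
    exfalso
    have n1 : a ≠ c := by rintro rfl; omega
    have n2 : b ≠ d := by rintro rfl; omega
    rcases (ofPairs_rel hS hac).resolve_left n1 with h1 | h1 <;>
      rcases (ofPairs_rel hS hbd).resolve_left n2 with h2 | h2 <;>
      rcases hS _ h1 _ h2 with h | h
    all_goals first
      | (simp only [Prod.mk.injEq] at h
         obtain ⟨rfl, rfl⟩ := h
         omega)
      | (have := h.2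
         simp only [Between] at this
         omega)
  · refine (isPartialBrauer_iff _).2 fun x y z hxy hxz => ?_
    by_contra! hn
    rcases (ofPairs_rel hS hxy).resolve_left hn.1 with h1 | h1 <;>
      rcases (ofPairs_rel hS hxz).resolve_left hn.2.1 with h2 | h2 <;>
      rcases hS _ h1 _ h2 with h | h
    all_goals first
      | (simp only [Prod.mk.injEq] at h
         grind)
      | (have := h.1
         simp at this)

/-- The partition all of whose blocks are singletons. -/
def discrete : PartitionMonoid n := ofPairs ∅

/-- The partition whose only nontrivial block is `{x, y}`. -/
def pair (x y : Fin n ⊕ Fin n) : PartitionMonoid n := ofPairs {(x, y)}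

/-- The partition whose only nontrivial blocks are `{x, y}` and `{z, w}`. -/
def twoPairs (x y z w : Fin n ⊕ Fin n) : PartitionMonoid n := ofPairs {(x, y), (z, w)}

theorem inv_discrete (p q : Fin n → Prop) : Inv discrete p q ↔ True := by
  simp [discrete, inv_ofPairs]

theorem inv_pair (x y) (p q : Fin n → Prop) :
    Inv (pair x y) p q ↔ (Sum.elim p q x ↔ Sum.elim p q y) := by
  simp [pair, inv_ofPairs]

theorem inv_twoPairs (x y z w) (p q : Fin n → Prop) : Inv (twoPairs x y z w) p q ↔
    (Sum.elim p q x ↔ Sum.elim p q y) ∧ (Sum.elim p q z ↔ Sum.elim p q w) := by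
  simp [twoPairs, inv_ofPairs]

theorem discrete_mem : discrete ∈ motzkin n := ofPairs_mem_motzkin (by simp)

theorem pair_mem (x y : Fin n ⊕ Fin n) : pair x y ∈ motzkin n := ofPairs_mem_motzkin (by simp)

theorem twoPairs_mem {x y z w : Fin n ⊕ Fin n} (h : Apart (x, y) (z, w)) :
    twoPairs x y z w ∈ motzkin n := by
  refine ofPairs_mem_motzkin ?_
  -- `Apart` is asymmetric in form; for four distinct endpoints noncrossing is symmetric.
  have h' : Apart (z, w) (x, y) := by
    obtain ⟨⟨h1, h2, h3, h4⟩, h5⟩ := h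
    refine ⟨⟨h1.symm, h3.symm, h2.symm, h4.symm⟩, ?_⟩
    have h1 := pos_injective.ne h1
    have h2 := pos_injective.ne h2
    have h3 := pos_injective.ne h3
    have h4 := pos_injective.ne h4
    simp only [Between] at *
    omega
  simp [h, h']

/-! ### Projections -/

/-- `ε² = ε = ε*`. -/
structure IsProjection (ε : PartitionMonoid n) : Prop where
  idem : ε * ε = ε
  star_eq : star ε = ε

/-- `i` lies in a transversal block, namely in that of `i'`. -/
def Dom (ε : PartitionMonoid n) (i : Fin n) : Prop := ε.Rel (Sum.inl i) (Sum.inr i)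

/-- `i` and `j` lie in the same block. -/
def Ker (ε : PartitionMonoid n) (i j : Fin n) : Prop := ε.Rel (Sum.inl i) (Sum.inl j)

namespace IsProjection

variable {ε η : PartitionMonoid n}

theorem rel_swap (h : IsProjection ε) {x y} : ε.Rel x.swap y.swap ↔ ε.Rel x y := by
  conv_rhs => rw [← h.star_eq]
  rfl

theorem rel_inr_inr (h : IsProjection ε) {i j} : ε.Rel (Sum.inr i) (Sum.inr j) ↔ ε.Ker i j :=
  h.rel_swap (x := Sum.inl i) (y := Sum.inl j)

/-- Follow the path from `i` down to `j` in the first copy of `ε`, then its mirror image in the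
second, and use `ε² = ε`. -/
theorem dom_of_rel (h : IsProjection ε) {i j} (hij : ε.Rel (Sum.inl i) (Sum.inr j)) :
    ε.Dom i := by
  have hji : ε.Rel (Sum.inr i) (Sum.inl j) := (h.rel_swap (x := Sum.inl i) (y := Sum.inr j)).2 hij
  have : (ε * ε).Rel (Sum.inl i) (Sum.inr i) :=
    (Relation.EqvGen.rel _ _ (.left (Sum.inl i) (Sum.inr j) hij)).trans _ _ _
      (.rel _ _ (.right (Sum.inl j) (Sum.inr i) hji.symm))
  rwa [h.idem] at this

theorem rel_inl_inr (h : IsProjection ε) {i j} :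
    ε.Rel (Sum.inl i) (Sum.inr j) ↔ ε.Ker i j ∧ ε.Dom i :=
  ⟨fun hij => ⟨hij.trans ((h.dom_of_rel ((h.rel_swap (x := Sum.inl i) (y := Sum.inr j)).2
    hij).symm)).symm, h.dom_of_rel hij⟩, fun hij => hij.2.trans (h.rel_inr_inr.2 hij.1)⟩

/-- Symmetry gives the lower row, and `rel_inl_inr` the connections between the rows. Recovering a
projection thus means recovering `Ker` and `Dom`. -/
theorem eq_of_ker_dom (hε : IsProjection ε) (hη : IsProjection η) (hK : ∀ i j, ε.Ker i j ↔ η.Ker i j)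
    (hD : ∀ i, ε.Dom i ↔ η.Dom i) : ε = η := by
  ext x y
  change ε.Rel x y ↔ η.Rel x y
  rcases x with i | i <;> rcases y with j | j
  · exact hK i j
  · rw [hε.rel_inl_inr, hη.rel_inl_inr, hK, hD]
  · constructor <;> intro h <;> refine Rel.symm ?_ <;> have h := h.symm
    · rwa [hε.rel_inl_inr, hK, hD, ← hη.rel_inl_inr] at h
    · rwa [hη.rel_inl_inr, ← hK, ← hD, ← hε.rel_inl_inr] at h
  · rw [hε.rel_inr_inr, hη.rel_inr_inr, hK]

end IsProjection

theorem Ker.refl (ε : PartitionMonoid n) (i) : ε.Ker i i := Rel.refl _ _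
theorem Ker.symm {ε : PartitionMonoid n} {i j} (h : ε.Ker i j) : ε.Ker j i := Rel.symm h
theorem Ker.trans {ε : PartitionMonoid n} {i j k} (h : ε.Ker i j) (h' : ε.Ker j k) : ε.Ker i k :=
  Rel.trans h h'

theorem IsProjection.dom_congr {ε : PartitionMonoid n} (h : IsProjection ε) {i j}
    (hij : ε.Ker i j) (hi : ε.Dom i) : ε.Dom j :=
  h.dom_of_rel (Rel.trans (Rel.symm hij) hi)

theorem exists_ker_of_rank_le_two {ε : PartitionMonoid n} (h : ε.rank ≤ 2) {i j k}
    (hi : ε.Dom i) (hj : ε.Dom j) (hk : ε.Dom k) : ε.Ker i j ∨ ε.Ker i k ∨ ε.Ker j k := by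
  by_contra! hn
  have key : ∀ i j, ¬ ε.Ker i j → {x | ε.blocks x (Sum.inl i)} ≠ {x | ε.blocks x (Sum.inl j)} := by
    intro i j hij e
    have : Sum.inl i ∈ {x | ε.blocks x (Sum.inl j)} := e ▸ Rel.refl ε _
    exact hij this
  have mem : ∀ i, ε.Dom i → {x | ε.blocks x (Sum.inl i)} ∈
      {B : Set (Fin n ⊕ Fin n) | B ∈ ε.blocks.classes ∧
        (∃ i, Sum.inl i ∈ B) ∧ (∃ j, Sum.inr j ∈ B)} := fun i hi =>
    ⟨ε.blocks.mem_classes _, ⟨i, Rel.refl ε _⟩, ⟨i, Rel.symm hi⟩⟩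
  have h1 : 2 < ε.rank := (Set.two_lt_ncard_iff (Set.toFinite _)).2
    ⟨_, _, _, mem i hi, mem j hj, mem k hk, key _ _ hn.1, key _ _ hn.2.1, key _ _ hn.2.2⟩
  omega

/-- The transversal blocks of a projection of rank at most two. -/
theorem dom_cases {ε : PartitionMonoid n} (h : ε.rank ≤ 2) :
    (∀ i, ¬ ε.Dom i) ∨ (∃ a, ε.Dom a ∧ ∀ i, ε.Dom i → ε.Ker a i) ∨
    ∃ a b, a < b ∧ ε.Dom a ∧ ε.Dom b ∧ ¬ ε.Ker a b ∧ ∀ i, ε.Dom i → ε.Ker a i ∨ ε.Ker b i := by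
  by_cases h0 : ∀ i, ¬ ε.Dom i
  · exact .inl h0
  push Not at h0
  obtain ⟨a, ha⟩ := h0
  by_cases h1 : ∀ i, ε.Dom i → ε.Ker a i
  · exact .inr (.inl ⟨a, ha, h1⟩)
  push Not at h1
  obtain ⟨b, hb, hab⟩ := h1
  refine .inr (.inr ?_)
  have h2 : ∀ i, ε.Dom i → ε.Ker a i ∨ ε.Ker b i := fun i hi =>
    (exists_ker_of_rank_le_two h ha hb hi).resolve_left hab
  rcases lt_trichotomy a b with hlt | rfl | hlt
  · exact ⟨a, b, hlt, ha, hb, hab, h2⟩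
  · exact absurd (Ker.refl ε a) hab
  · exact ⟨b, a, hlt, hb, ha, fun h => hab h.symm, fun i hi => (h2 i hi).symm⟩

/-! ### Probing a projection from both sides -/

theorem Inv.right_of_ker {ε : PartitionMonoid n} (hε : IsProjection ε) {p q} (h : Inv ε p q) {i j}
    (hij : ε.Ker i j) : q i ↔ q j := h _ _ (hε.rel_inr_inr.2 hij)

theorem Inv.of_dom {ε : PartitionMonoid n} {p q} (h : Inv ε p q) {i} (hi : ε.Dom i) :
    p i ↔ q i := h _ _ hi

/-- The invariant set that consists of the blocks of `a'` and `b'`. -/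
theorem IsProjection.exists_inv {ε : PartitionMonoid n} (hε : IsProjection ε) (a b : Fin n) :
    ∃ p, Inv ε p (fun i => ε.Ker a i ∨ ε.Ker b i) ∧
      ∀ i, p i ↔ ε.Dom i ∧ (ε.Ker a i ∨ ε.Ker b i) := by
  have h := (inv_class ε (Sum.inr a)).or (inv_class ε (Sum.inr b))
  simp only [hε.rel_inr_inr] at h
  refine ⟨_, h, fun i => ?_⟩
  have : ∀ a, ε.Rel (Sum.inr a) (Sum.inl i) ↔ ε.Dom i ∧ ε.Ker a i := fun a => by
    constructor
    · intro h
      have := hε.rel_inl_inr.1 h.symm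
      exact ⟨this.2, this.1.symm⟩
    · rintro ⟨h1, h2⟩
      exact (hε.rel_inl_inr.2 ⟨h2.symm, h1⟩).symm
  rw [this, this, and_or_left]

/-- Joining `s` to `t` and `i` to `j` in the lower row of `ε` connects `a` and `b`. -/
def Joins (ε : PartitionMonoid n) (a b s t i j : Fin n) : Prop :=
  ∀ p q, Inv ε p q → (q s ↔ q t) → (q i ↔ q j) → (p a ↔ p b)

/-- Joining `s` to `t` in the lower row of `ε` connects `a` and `i'`. -/
def Reaches (ε : PartitionMonoid n) (a s t i : Fin n) : Prop :=
  ∀ p q, Inv ε p q → (q s ↔ q t) → (p a ↔ q i)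

section

variable {o o' a b i j s t : Fin n} {ε : PartitionMonoid n}

/-- Joining `a` to `b` below `ε` by means of pairs of lower vertices. -/
theorem twoPairs_mul_mul_of_joins (h : ε.Joins a b s t i j) :
    twoPairs (.inl o) (.inr a) (.inl o') (.inr b) * (ε * twoPairs (.inl s) (.inl t) (.inl i) (.inl j))
      = pair (.inl o) (.inl o') := eq_of_inv fun p r => by
  simp only [inv_mul, inv_twoPairs, inv_pair, Sum.elim_inl, Sum.elim_inr]
  constructor
  · rintro ⟨q, ⟨h1, h2⟩, q', h3, h4, h5⟩
    rw [h1, h2, h _ _ h3 h4 h5]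
  · intro h
    exact ⟨fun _ => p o, ⟨Iff.rfl, h.symm⟩, fun _ => p o, inv_const _ _, Iff.rfl, Iff.rfl⟩

/-- A predicate witnessing the failure takes different values at `a` and `b`. `Inv.choice` replaces
these two values by arbitrary ones, so the product imposes no constraint on the outer vertices. -/
theorem twoPairs_mul_mul_of_not_joins (h : ¬ ε.Joins a b s t i j) :
    twoPairs (.inl o) (.inr a) (.inl o') (.inr b) * (ε * twoPairs (.inl s) (.inl t) (.inl i) (.inl j))
      = discrete := eq_of_inv fun p r => by
  simp only [inv_mul, inv_twoPairs, inv_discrete, Sum.elim_inl, Sum.elim_inr, iff_true]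
  simp only [Joins] at h
  push Not at h
  obtain ⟨p', q', h1, h2, h3, ⟨h4, h5⟩ | ⟨h4, h5⟩⟩ := h
  · exact ⟨_, ⟨by simp [h4], by simp [h5]⟩, _, h1.choice (p o) (p o'), by simp [h2], by simp [h3]⟩
  · exact ⟨_, ⟨by simp [h4], by simp [h5]⟩, _, h1.choice (p o') (p o), by simp [h2], by simp [h3]⟩

theorem pair_mul_mul_twoPairs :
    pair (.inl o) (.inr a) * (ε * twoPairs (.inl s) (.inl t) (.inl i) (.inl j)) = discrete :=
  eq_of_inv fun p r => by
    simp only [inv_mul, inv_twoPairs, inv_pair, inv_discrete, Sum.elim_inl, Sum.elim_inr, iff_true]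
    exact ⟨fun _ => p o, Iff.rfl, fun _ => p o, inv_const _ _, Iff.rfl, Iff.rfl⟩

theorem pair_mul_mul_of_reaches (h : ε.Reaches a s t i) :
    pair (.inl o) (.inr a) * (ε * twoPairs (.inl s) (.inl t) (.inl i) (.inr o)) =
      pair (.inl o) (.inr o) := eq_of_inv fun p r => by
  simp only [inv_mul, inv_twoPairs, inv_pair, Sum.elim_inl, Sum.elim_inr]
  constructor
  · rintro ⟨q, h1, q', h3, h4, h5⟩
    rw [h1, h _ _ h3 h4, h5]
  · intro h
    exact ⟨fun _ => p o, Iff.rfl, fun _ => p o, inv_const _ _, Iff.rfl, h⟩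

theorem pair_mul_mul_of_not_reaches (h : ¬ ε.Reaches a s t i) :
    pair (.inl o) (.inr a) * (ε * twoPairs (.inl s) (.inl t) (.inl i) (.inr o)) = discrete :=
  eq_of_inv fun p r => by
  simp only [inv_mul, inv_twoPairs, inv_pair, inv_discrete, Sum.elim_inl, Sum.elim_inr, iff_true]
  simp only [Reaches] at h
  push Not at h
  obtain ⟨p', q', h1, h2, ⟨h4, h5⟩ | ⟨h4, h5⟩⟩ := h
  · exact ⟨_, by simp [h4], _, h1.choice (p o) (r o), by simp [h2], by simp [h5]⟩
  · exact ⟨_, by simp [h4], _, h1.choice (r o) (p o), by simp [h2], by simp [h5]⟩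

/-- The factor `discrete` cuts off the upper row, so only the connections among the lower vertices
of `ε` remain visible. -/
theorem discrete_mul_mul_of_ker (hε : IsProjection ε) (h : ε.Ker i j) :
    discrete * (ε * twoPairs (.inl i) (.inr o) (.inl j) (.inr o')) = pair (.inr o) (.inr o') :=
  eq_of_inv fun p r => by
    simp only [inv_mul, inv_twoPairs, inv_pair, inv_discrete, Sum.elim_inl, Sum.elim_inr, true_and]
    constructor
    · rintro ⟨q, q', h3, h4, h5⟩
      rw [← h4, ← h5, h3.right_of_ker hε h]
    · intro h
      exact ⟨fun _ => r o, fun _ => r o, inv_const _ _, Iff.rfl, h⟩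

theorem discrete_mul_mul_of_not_ker (hε : IsProjection ε) (h : ¬ ε.Ker i j) :
    discrete * (ε * twoPairs (.inl i) (.inr o) (.inl j) (.inr o')) = discrete :=
  eq_of_inv fun p r => by
    simp only [inv_mul, inv_twoPairs, inv_discrete, Sum.elim_inl, Sum.elim_inr, true_and, iff_true]
    obtain ⟨p', h1, -⟩ := hε.exists_inv i i
    refine ⟨_, _, h1.choice (r o) (r o'), ?_, ?_⟩
    · simp [Ker.refl]
    · simp [h]

theorem discrete_mul_mul_twoPairs :
    discrete * (ε * twoPairs (.inl s) (.inl t) (.inl i) (.inl j)) = discrete :=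
  eq_of_inv fun p r => by
    simp only [inv_mul, inv_twoPairs, inv_discrete, Sum.elim_inl, true_and, iff_true]
    exact ⟨fun _ => True, fun _ => True, inv_const _ _, Iff.rfl, Iff.rfl⟩

theorem discrete_mul_mul_pair :
    discrete * (ε * pair (.inl s) (.inr t)) = discrete :=
  eq_of_inv fun p r => by
    simp only [inv_mul, inv_pair, inv_discrete, Sum.elim_inl, Sum.elim_inr, true_and, iff_true]
    exact ⟨fun _ => r t, fun _ => r t, inv_const _ _, Iff.rfl⟩

end

/-! ### Recovering a projection from its probes -/

/-- `ε` is a projection of rank two, with transversal blocks through `a < b`. -/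
structure IsRankTwo (ε : PartitionMonoid n) (a b : Fin n) : Prop where
  proj : IsProjection ε
  lt : a < b
  dom_left : ε.Dom a
  dom_right : ε.Dom b
  not_ker : ¬ ε.Ker a b
  cover : ∀ i, ε.Dom i → ε.Ker a i ∨ ε.Ker b i

/-- `ε` is a projection of rank one, with transversal block through `a`. -/
structure IsRankOne (ε : PartitionMonoid n) (a : Fin n) : Prop where
  proj : IsProjection ε
  dom : ε.Dom a
  cover : ∀ i, ε.Dom i → ε.Ker a i

section

variable {ε η : PartitionMonoid n} {a b c d i j s t : Fin n}

/-! ### Projections of rank two. -/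

theorem IsRankTwo.joins_iff (h : IsRankTwo ε a b) :
    ε.Joins a b s t s t ↔ (ε.Ker a s ∧ ε.Ker b t) ∨ (ε.Ker a t ∧ ε.Ker b s) := by
  constructor
  · intro hj
    have key : ∀ s t, ε.Ker a s → ¬ ε.Ker a t → ε.Joins a b s t s t → ε.Ker b t := by
      intro s t hs ht hj
      by_contra hb
      -- The blocks of `a'` and `t'` together respect the join of `s` and `t`, and contain `a`;
      -- hence they contain `b`.
      obtain ⟨p, h1, h2⟩ := h.proj.exists_inv a t
      have := hj _ _ h1 (by simp [hs, Ker.refl]) (by simp [hs, Ker.refl])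
      simp only [h2, h.dom_left, h.dom_right, Ker.refl, h.not_ker, true_and, true_or, false_or,
        true_iff] at this
      exact hb this.symm
    by_cases hs : ε.Ker a s <;> by_cases ht : ε.Ker a t
    · obtain ⟨p, h1, h2⟩ := h.proj.exists_inv a a
      have := hj _ _ h1 (by simp [hs, ht]) (by simp [hs, ht])
      simp [h2, h.dom_left, h.dom_right, h.not_ker, Ker.refl] at this
    · exact .inl ⟨hs, key s t hs ht hj⟩
    · exact .inr ⟨ht, key t s ht hs fun p q h1 h2 h3 => hj p q h1 h2.symm h3.symm⟩
    · obtain ⟨p, h1, h2⟩ := h.proj.exists_inv a a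
      have := hj _ _ h1 (by simp [hs, ht]) (by simp [hs, ht])
      simp [h2, h.dom_left, h.dom_right, h.not_ker, Ker.refl] at this
  · intro hst p q h1 h2 _
    rw [h1.of_dom h.dom_left, h1.of_dom h.dom_right]
    rcases hst with ⟨h3, h4⟩ | ⟨h3, h4⟩
    · rw [h1.right_of_ker h.proj h3, h1.right_of_ker h.proj h4, h2]
    · rw [h1.right_of_ker h.proj h3, h1.right_of_ker h.proj h4, h2]

theorem IsRankTwo.joins_of_ker (h : IsRankTwo ε a b) (hij : ε.Ker i j) :
    ε.Joins a b a i j b := by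
  intro p q h1 h2 h3
  rw [h1.of_dom h.dom_left, h1.of_dom h.dom_right, h2, ← h3, h1.right_of_ker h.proj hij]

/-- The union of the lower blocks of `a` and `i` respects both joins, but contains exactly one of
the two transversal blocks. -/
theorem IsRankTwo.not_joins_of_not_ker (h : IsRankTwo η c d)
    (hab : (η.Ker c a ∧ η.Ker d b) ∨ (η.Ker c b ∧ η.Ker d a))
    (hi : ¬ η.Dom i) (hj : ¬ η.Dom j) (hij : ¬ η.Ker i j) : ¬ η.Joins c d a i j b := by
  intro hJ
  obtain ⟨p, h1, h2⟩ := h.proj.exists_inv a i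
  have nd : ∀ x, η.Dom x → ¬ η.Ker i x := fun x hx hix => hi (h.proj.dom_congr hix.symm hx)
  have hcd := h.not_ker
  have hc := h.dom_left
  have hd := h.dom_right
  have ha : η.Dom a := by
    rcases hab with h' | h'
    exacts [h.proj.dom_congr h'.1 hc, h.proj.dom_congr h'.2 hd]
  have hb : η.Dom b := by
    rcases hab with h' | h'
    exacts [h.proj.dom_congr h'.2 hd, h.proj.dom_congr h'.1 hc]
  have haj : ¬ η.Ker a j := fun haj => hj (h.proj.dom_congr haj ha)
  have hnab : ¬ η.Ker a b := by
    intro h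
    rcases hab with h' | h'
    · exact hcd (h'.1.trans (h.trans h'.2.symm))
    · exact hcd (h'.1.trans (h.symm.trans h'.2.symm))
  have := hJ _ _ h1 (by simp [Ker.refl]) (by simp [haj, hij, hnab, nd b hb])
  simp only [h2, hc, hd, nd c hc, nd d hd, true_and, or_false] at this
  rcases hab with h | h
  · exact hcd (h.1.trans (this.1 h.1.symm))
  · exact hcd ((this.2 h.2.symm).symm.trans h.2.symm)

/-- Of the three pairings of four points on a line only one crosses, so one of these two is planar.
This makes a Motzkin probe for `Ker i j` available. -/
theorem apart_or_apart (hab : a < b) (hij : i ≠ j) (hai : a ≠ i) (haj : a ≠ j) (hbi : b ≠ i)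
    (hbj : b ≠ j) : Apart ((.inl a : Fin n ⊕ Fin n), .inl i) (.inl j, .inl b) ∨
      Apart ((.inl a : Fin n ⊕ Fin n), .inl j) (.inl i, .inl b) := by
  simp only [Apart, Between, pos, Sum.elim_inl, ne_eq, Sum.inl.injEq, Fin.ext_iff] at *
  omega

theorem dom_of_joins_imp (h : IsRankTwo ε a b) (h' : IsRankTwo η c d)
    (H : ∀ s t, ε.Joins a b s t s t → η.Joins c d s t s t) (hi : ε.Dom i) : η.Dom i := by
  have key : ∀ s t, (ε.Ker a s ∧ ε.Ker b t) ∨ (ε.Ker a t ∧ ε.Ker b s) → η.Dom s ∧ η.Dom t := by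
    intro s t hst
    rcases h'.joins_iff.1 (H s t (h.joins_iff.2 hst)) with ⟨h1, h2⟩ | ⟨h1, h2⟩
    · exact ⟨h'.proj.dom_congr h1 h'.dom_left, h'.proj.dom_congr h2 h'.dom_right⟩
    · exact ⟨h'.proj.dom_congr h2 h'.dom_right, h'.proj.dom_congr h1 h'.dom_left⟩
  rcases h.cover i hi with h1 | h1
  · exact (key i b (.inl ⟨h1, Ker.refl _ _⟩)).1
  · exact (key i a (.inr ⟨Ker.refl _ _, h1⟩)).1

theorem ker_of_joins_iff (h : IsRankTwo ε a b) (h' : IsRankTwo η c d)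
    (H : ∀ s t i j, twoPairs (.inl s) (.inl t) (.inl i) (.inl j) ∈ motzkin n →
      (ε.Joins a b s t i j ↔ η.Joins c d s t i j)) (hij : ε.Ker i j) : η.Ker i j := by
  have H1 : ∀ s t, ε.Joins a b s t s t ↔ η.Joins c d s t s t := fun s t =>
    H s t s t (by simpa [twoPairs, pair] using pair_mem (.inl s : Fin n ⊕ Fin n) (.inl t))
  have hD : ∀ i, ε.Dom i ↔ η.Dom i := fun i =>
    ⟨dom_of_joins_imp h h' fun s t => (H1 s t).1, dom_of_joins_imp h' h fun s t => (H1 s t).2⟩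
  have hab := h'.joins_iff.1 ((H1 a b).1 (h.joins_iff.2 (.inl ⟨Ker.refl _ _, Ker.refl _ _⟩)))
  by_contra hn
  have hn' : ¬ η.Ker j i := fun h => hn h.symm
  by_cases hi : ε.Dom i
  · have hj := h.proj.dom_congr hij hi
    -- If `i` and `j` were in different blocks of `η`, these would be its two transversals, and
    -- joining `i` to `j` would connect them; in `ε` it does not.
    have hJ : η.Joins c d i j i j := by
      rw [h'.joins_iff]
      rcases h'.cover i ((hD i).1 hi) with h1 | h1 <;> rcases h'.cover j ((hD j).1 hj) with h2 | h2
      · exact absurd (h1.symm.trans h2) hn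
      · exact .inl ⟨h1, h2⟩
      · exact .inr ⟨h2, h1⟩
      · exact absurd (h1.symm.trans h2) hn
    rcases h.joins_iff.1 ((H1 i j).2 hJ) with ⟨h1, h2⟩ | ⟨h1, h2⟩
    · exact h.not_ker (h1.trans (hij.trans h2.symm))
    · exact h.not_ker (h1.trans (hij.symm.trans h2.symm))
  · have hj : ¬ ε.Dom j := fun hj => hi (h.proj.dom_congr hij.symm hj)
    have hi' := mt (hD i).2 hi
    have hj' := mt (hD j).2 hj
    rcases apart_or_apart h.lt (i := i) (j := j) (by rintro rfl; exact hn (Ker.refl _ _))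
      (by rintro rfl; exact hi h.dom_left) (by rintro rfl; exact hj h.dom_left)
      (by rintro rfl; exact hi h.dom_right) (by rintro rfl; exact hj h.dom_right) with hA | hA
    · exact h'.not_joins_of_not_ker hab hi' hj' hn
        ((H _ _ _ _ (twoPairs_mem hA)).1 (h.joins_of_ker hij))
    · exact h'.not_joins_of_not_ker hab hj' hi' hn'
        ((H _ _ _ _ (twoPairs_mem hA)).1 (h.joins_of_ker hij.symm))

theorem IsRankTwo.eq_of_joins_iff (h : IsRankTwo ε a b) (h' : IsRankTwo η c d)
    (H : ∀ s t i j, twoPairs (.inl s) (.inl t) (.inl i) (.inl j) ∈ motzkin n →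
      (ε.Joins a b s t i j ↔ η.Joins c d s t i j)) : ε = η := by
  have H1 : ∀ s t, ε.Joins a b s t s t ↔ η.Joins c d s t s t := fun s t =>
    H s t s t (by simpa [twoPairs, pair] using pair_mem (.inl s : Fin n ⊕ Fin n) (.inl t))
  exact h.proj.eq_of_ker_dom h'.proj
    (fun i j => ⟨ker_of_joins_iff h h' H,
      ker_of_joins_iff h' h fun s t i j hm => (H s t i j hm).symm⟩)
    (fun i => ⟨dom_of_joins_imp h h' fun s t => (H1 s t).1,
      dom_of_joins_imp h' h fun s t => (H1 s t).2⟩)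

/-! ### Projections of rank one. -/

theorem IsRankOne.reaches_iff (h : IsRankOne ε a) : ε.Reaches a i i i ↔ ε.Dom i := by
  constructor
  · intro hr
    obtain ⟨p, h1, h2⟩ := h.proj.exists_inv a a
    have := hr _ _ h1 Iff.rfl
    simp only [h2, h.dom, Ker.refl, or_self, and_self, true_iff] at this
    exact h.proj.dom_congr this h.dom
  · intro hi p q h1 _
    rw [h1.of_dom h.dom, h1.right_of_ker h.proj (h.cover i hi)]

theorem IsRankOne.reaches_of_ker (h : IsRankOne ε a) (hij : ε.Ker i j) : ε.Reaches a a i j := by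
  intro p q h1 h2
  rw [h1.of_dom h.dom, h2, h1.right_of_ker h.proj hij]

theorem IsRankOne.not_reaches_of_not_ker (h : IsRankOne η c) (ha : η.Dom a) (hj : ¬ η.Dom j)
    (hij : ¬ η.Ker i j) : ¬ η.Reaches c a i j := by
  intro hr
  obtain ⟨p, h1, h2⟩ := h.proj.exists_inv a i
  have := hr _ _ h1 (by simp [Ker.refl])
  simp only [h2, h.dom, (h.cover a ha).symm, true_or, and_self, true_iff] at this
  exact this.elim (fun haj => hj (h.proj.dom_congr haj ha)) hij

theorem ker_of_reaches_iff {o : Fin n} (ho : o.val = 0) (h : IsRankOne ε a) (h' : IsRankOne η c)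
    (H : ∀ s t i, twoPairs (.inl s) (.inl t) (.inl i) (.inr o) ∈ motzkin n →
      (ε.Reaches a s t i ↔ η.Reaches c s t i)) (hD : ∀ i, ε.Dom i ↔ η.Dom i) (hij : ε.Ker i j) :
    η.Ker i j := by
  by_contra hn
  have hn' : ¬ η.Ker j i := fun h => hn h.symm
  by_cases hi : ε.Dom i
  · have hj := h.proj.dom_congr hij hi
    exact hn ((h'.cover i ((hD i).1 hi)).symm.trans (h'.cover j ((hD j).1 hj)))
  · have hj : ¬ ε.Dom j := fun hj => hi (h.proj.dom_congr hij.symm hj)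
    have hi' := mt (hD i).2 hi
    have hj' := mt (hD j).2 hj
    have ha := (hD a).1 h.dom
    -- As in `apart_or_apart`, with the lower vertex of `o`, last on the boundary, in the role of
    -- `b`.
    have hA : Apart ((.inl a : Fin n ⊕ Fin n), .inl i) (.inl j, .inr o) ∨
        Apart ((.inl a : Fin n ⊕ Fin n), .inl j) (.inl i, .inr o) := by
      have h1 : i ≠ j := by rintro rfl; exact hn (Ker.refl _ _)
      have h2 : a ≠ i := by rintro rfl; exact hi h.dom
      have h3 : a ≠ j := by rintro rfl; exact hj h.dom
      simp only [Apart, Between, pos, Sum.elim_inl, Sum.elim_inr, ne_eq, Sum.inl.injEq,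
        Fin.ext_iff, reduceCtorEq, not_false_eq_true, true_and, and_true, ho] at h1 h2 h3 ⊢
      omega
    rcases hA with hA | hA
    · exact h'.not_reaches_of_not_ker ha hj' hn
        ((H _ _ _ (twoPairs_mem hA)).1 (h.reaches_of_ker hij))
    · exact h'.not_reaches_of_not_ker ha hi' hn'
        ((H _ _ _ (twoPairs_mem hA)).1 (h.reaches_of_ker hij.symm))

theorem twoPairs_self_mem (x y : Fin n ⊕ Fin n) : twoPairs x x x y ∈ motzkin n := by
  have : twoPairs x x x y = pair x y := eq_of_inv fun p q => by simp [inv_twoPairs, inv_pair]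
  rw [this]
  exact pair_mem _ _

theorem IsRankOne.eq_of_reaches_iff {o : Fin n} (ho : o.val = 0) (h : IsRankOne ε a)
    (h' : IsRankOne η c)
    (H : ∀ s t i, twoPairs (.inl s) (.inl t) (.inl i) (.inr o) ∈ motzkin n →
      (ε.Reaches a s t i ↔ η.Reaches c s t i)) : ε = η := by
  have hD : ∀ i, ε.Dom i ↔ η.Dom i := fun i => by
    rw [← h.reaches_iff, ← h'.reaches_iff]
    exact H i i i (twoPairs_self_mem _ _)
  exact h.proj.eq_of_ker_dom h'.proj
    (fun i j => ⟨ker_of_reaches_iff ho h h' H hD,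
      ker_of_reaches_iff ho h' h (fun s t i hm => (H s t i hm).symm) fun i => (hD i).symm⟩) hD

end

/-! ### Counting the points of a faithful action -/

theorem pair_ne_discrete {x y : Fin n ⊕ Fin n} (h : x ≠ y) : pair x y ≠ discrete := by
  intro e
  have h1 : (pair x y).Rel x y := .rel _ _ rfl
  rw [e] at h1
  rcases ofPairs_rel (by simp) h1 with h2 | h2 | h2
  exacts [h h2, h2, h2]

section

variable {M : Submonoid (PartitionMonoid n)} {X : Type*} (A : X → PartitionMonoid n → X)
  (o o' : Fin n) (x w u z : X)

/-- The points of `X` attached to the projections of rank at most two, and the extra point `z`. -/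
inductive IsPoint (M : Submonoid (PartitionMonoid n)) :
    Option (PartitionMonoid n) → X → Prop
  | rankTwo (ε a b) : ε ∈ M → IsRankTwo ε a b →
      IsPoint M (some ε) (A x (twoPairs (.inl o) (.inr a) (.inl o') (.inr b) * ε))
  | rankOne (ε a) : ε ∈ M → IsRankOne ε a →
      IsPoint M (some ε) (A w (pair (.inl o) (.inr a) * ε))
  | rankZero (ε) : ε ∈ M → IsProjection ε → (∀ i, ¬ ε.Dom i) →
      IsPoint M (some ε) (A u (discrete * ε))
  | extra : IsPoint M none z

theorem exists_isPoint (ε : PartitionMonoid n) (hε : ε ∈ lowRankProjections M) :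
    ∃ y, IsPoint A o o' x w u z M (some ε) y := by
  obtain ⟨hM, h1, h2, h3⟩ := hε
  rcases dom_cases h3 with h | ⟨a, ha, h⟩ | ⟨a, b, hlt, ha, hb, hab, h⟩
  · exact ⟨_, .rankZero ε hM ⟨h1, h2⟩ h⟩
  · exact ⟨_, .rankOne ε a hM ⟨⟨h1, h2⟩, ha, h⟩⟩
  · exact ⟨_, .rankTwo ε a b hM ⟨⟨h1, h2⟩, hlt, ha, hb, hab, h⟩⟩

variable {A o o' x w u z}

/-- The two strands do not cross because `o < o'` and `a < b`; this is why `IsRankTwo` orders its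
representatives. -/
theorem rankTwo_left_mem (ho : o.val = 0) (ho' : o'.val = 1) {a b : Fin n} (hab : a < b) :
    twoPairs (.inl o) (.inr a) (.inl o') (.inr b) ∈ motzkin n := by
  refine twoPairs_mem ?_
  simp only [Apart, Between, pos, Sum.elim_inl, Sum.elim_inr, ne_eq, Sum.inl.injEq, Sum.inr.injEq,
    Fin.ext_iff, Fin.lt_def, reduceCtorEq, not_false_eq_true, true_and, ho, ho'] at hab ⊢
  omega

theorem rankZero_right_mem (ho : o.val = 0) (ho' : o'.val = 1) {i j : Fin n} (hij : i < j) :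
    twoPairs (.inl i) (.inr o) (.inl j) (.inr o') ∈ motzkin n := by
  refine twoPairs_mem ?_
  simp only [Apart, Between, pos, Sum.elim_inl, Sum.elim_inr, ne_eq, Sum.inl.injEq, Sum.inr.injEq,
    Fin.ext_iff, Fin.lt_def, reduceCtorEq, not_false_eq_true, and_true, ho, ho'] at hij ⊢
  omega

theorem twoPairs_self (a b : Fin n ⊕ Fin n) : twoPairs a b a b = pair a b := by
  simp [twoPairs, pair]

theorem twoPairs_refl_left (a b : Fin n ⊕ Fin n) : twoPairs a a a b = pair a b :=
  eq_of_inv fun p q => by simp [inv_twoPairs, inv_pair]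

/-- `A` is a faithful action, `x`, `w`, `u` separate three pairs of elements, and `z` is an image of
`x` under an element of rank zero, other than that of `u`. -/
structure IsFrame (A : X → PartitionMonoid n → X) (M : Submonoid (PartitionMonoid n)) (o o' : Fin n)
    (x w u z : X) : Prop where
  zero : o.val = 0
  one : o'.val = 1
  motzkin_le : motzkin n ≤ M
  mul : ∀ x, ∀ α ∈ M, ∀ β ∈ M, A (A x α) β = A x (α * β)
  sep_x : A x (pair (.inl o) (.inl o')) ≠ A x discrete
  sep_w : A w (pair (.inl o) (.inr o)) ≠ A w discrete
  sep_u : A u (pair (.inr o) (.inr o')) ≠ A u discrete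
  extra : z = A x (pair (.inl o) (.inl o')) ∨ z = A x discrete
  extra_ne : z ≠ A u discrete

/-- The hypotheses say that `α` does not constrain its lower row, and that `β` connects no two of
its lower vertices. -/
theorem mul_eq_left_of_inv {α β : PartitionMonoid n} (hα : ∀ p q r, Inv α p q → Inv α p r)
    (hβ : ∀ r, ∃ q, Inv β q r) : α * β = α := eq_of_inv fun p r => by
  rw [inv_mul]
  constructor
  · rintro ⟨q, h, -⟩
    exact hα _ _ _ h
  · intro h
    obtain ⟨q, hq⟩ := hβ r
    exact ⟨q, hα _ _ _ h, hq⟩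

/-- All partitions whose nontrivial blocks are upper pairs act on `y` in the same way. -/
def UpperConst (A : X → PartitionMonoid n → X) (y : X) : Prop :=
  ∃ v, ∀ s t i j, twoPairs (.inl s) (.inl t) (.inl i) (.inl j) ∈ motzkin n →
    A y (twoPairs (.inl s) (.inl t) (.inl i) (.inl j)) = v

/-- All partitions whose only nontrivial block is `{a, o'}` act on `y` in the same way. -/
def PairConst (A : X → PartitionMonoid n → X) (o : Fin n) (y : X) : Prop :=
  ∀ a, A y (pair (.inl a) (.inr o)) =
    -- This is `discrete`, written as a degenerate upper pairing so that the lemmas on those apply.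
    A y (twoPairs (.inl o) (.inl o) (.inl o) (.inl o))

/-! ### Distinguishing the points. -/

namespace IsFrame

variable (F : IsFrame A M o o' x w u z) {ε η : PartitionMonoid n} {a b c d i j s t : Fin n}
include F

theorem act_rankTwo_of_joins (hε : ε ∈ M) (h : IsRankTwo ε a b)
    (hm : twoPairs (.inl s) (.inl t) (.inl i) (.inl j) ∈ motzkin n) (hj : ε.Joins a b s t i j) :
    A (A x (twoPairs (.inl o) (.inr a) (.inl o') (.inr b) * ε))
      (twoPairs (.inl s) (.inl t) (.inl i) (.inl j)) = A x (pair (.inl o) (.inl o')) := by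
  rw [F.mul _ _ (M.mul_mem (F.motzkin_le (rankTwo_left_mem F.zero F.one h.lt)) hε) _
    (F.motzkin_le hm), mul_assoc, twoPairs_mul_mul_of_joins hj]

theorem act_rankTwo_of_not_joins (hε : ε ∈ M) (h : IsRankTwo ε a b)
    (hm : twoPairs (.inl s) (.inl t) (.inl i) (.inl j) ∈ motzkin n) (hj : ¬ ε.Joins a b s t i j) :
    A (A x (twoPairs (.inl o) (.inr a) (.inl o') (.inr b) * ε))
      (twoPairs (.inl s) (.inl t) (.inl i) (.inl j)) = A x discrete := by
  rw [F.mul _ _ (M.mul_mem (F.motzkin_le (rankTwo_left_mem F.zero F.one h.lt)) hε) _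
    (F.motzkin_le hm), mul_assoc, twoPairs_mul_mul_of_not_joins hj]

theorem joins_of_act_eq (hε : ε ∈ M) (h : IsRankTwo ε a b) (hη : η ∈ M) (h' : IsRankTwo η c d)
    (e : A x (twoPairs (.inl o) (.inr a) (.inl o') (.inr b) * ε) =
      A x (twoPairs (.inl o) (.inr c) (.inl o') (.inr d) * η))
    (hm : twoPairs (.inl s) (.inl t) (.inl i) (.inl j) ∈ motzkin n) (hj : ε.Joins a b s t i j) :
    η.Joins c d s t i j := by
  by_contra hn
  have h1 := F.act_rankTwo_of_joins hε h hm hj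
  rw [e, F.act_rankTwo_of_not_joins hη h' hm hn] at h1
  exact F.sep_x h1.symm

theorem eq_of_rankTwo (hε : ε ∈ M) (h : IsRankTwo ε a b) (hη : η ∈ M) (h' : IsRankTwo η c d)
    (e : A x (twoPairs (.inl o) (.inr a) (.inl o') (.inr b) * ε) =
      A x (twoPairs (.inl o) (.inr c) (.inl o') (.inr d) * η)) : ε = η :=
  h.eq_of_joins_iff h' fun _ _ _ _ hm =>
    ⟨F.joins_of_act_eq hε h hη h' e hm, F.joins_of_act_eq hη h' hε h e.symm hm⟩

theorem not_upperConst_rankTwo (hε : ε ∈ M) (h : IsRankTwo ε a b) :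
    ¬ UpperConst A (A x (twoPairs (.inl o) (.inr a) (.inl o') (.inr b) * ε)) := by
  rintro ⟨v, hv⟩
  have m : ∀ s t : Fin n, twoPairs (.inl s) (.inl t) (.inl s) (.inl t) ∈ motzkin n := fun s t => by
    rw [twoPairs_self]
    exact pair_mem _ _
  -- Joining `a` to `b` connects the transversals; joining `a` to itself does not.
  have h1 := F.act_rankTwo_of_joins hε h (m a b)
    (h.joins_iff.2 (.inl ⟨Ker.refl _ _, Ker.refl _ _⟩))
  have h2 := F.act_rankTwo_of_not_joins hε h (m a a) fun hj => by
    rcases h.joins_iff.1 hj with hj | hj <;> exact h.not_ker hj.2.symm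
  rw [hv _ _ _ _ (m _ _)] at h1 h2
  exact F.sep_x (h1.symm.trans h2)

theorem rankOne_left_mem (hε : ε ∈ M) : pair (.inl o) (.inr a) * ε ∈ M :=
  M.mul_mem (F.motzkin_le (pair_mem _ _)) hε

theorem discrete_mul_mem (hε : ε ∈ M) : discrete * ε ∈ M :=
  M.mul_mem (F.motzkin_le discrete_mem) hε

theorem act_rankOne_upper (hε : ε ∈ M)
    (hm : twoPairs (.inl s) (.inl t) (.inl i) (.inl j) ∈ motzkin n) :
    A (A w (pair (.inl o) (.inr a) * ε)) (twoPairs (.inl s) (.inl t) (.inl i) (.inl j)) =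
      A w discrete := by
  rw [F.mul _ _ (F.rankOne_left_mem hε) _ (F.motzkin_le hm), mul_assoc, pair_mul_mul_twoPairs]

theorem upperConst_rankOne (hε : ε ∈ M) : UpperConst A (A w (pair (.inl o) (.inr a) * ε)) :=
  ⟨_, fun _ _ _ _ hm => F.act_rankOne_upper hε hm⟩

theorem act_rankOne_of_reaches (hε : ε ∈ M)
    (hm : twoPairs (.inl s) (.inl t) (.inl i) (.inr o) ∈ motzkin n) (hj : ε.Reaches a s t i) :
    A (A w (pair (.inl o) (.inr a) * ε)) (twoPairs (.inl s) (.inl t) (.inl i) (.inr o)) =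
      A w (pair (.inl o) (.inr o)) := by
  rw [F.mul _ _ (F.rankOne_left_mem hε) _ (F.motzkin_le hm), mul_assoc, pair_mul_mul_of_reaches hj]

theorem reaches_of_act_eq (hε : ε ∈ M) (hη : η ∈ M)
    (e : A w (pair (.inl o) (.inr a) * ε) = A w (pair (.inl o) (.inr c) * η))
    (hm : twoPairs (.inl s) (.inl t) (.inl i) (.inr o) ∈ motzkin n) (hj : ε.Reaches a s t i) :
    η.Reaches c s t i := by
  by_contra hn
  have h1 := F.act_rankOne_of_reaches hε hm hj
  rw [e, F.mul _ _ (F.rankOne_left_mem hη) _ (F.motzkin_le hm), mul_assoc,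
    pair_mul_mul_of_not_reaches hn] at h1
  exact F.sep_w h1.symm

theorem eq_of_rankOne (hε : ε ∈ M) (h : IsRankOne ε a) (hη : η ∈ M) (h' : IsRankOne η c)
    (e : A w (pair (.inl o) (.inr a) * ε) = A w (pair (.inl o) (.inr c) * η)) : ε = η :=
  h.eq_of_reaches_iff F.zero h' fun _ _ _ hm =>
    ⟨F.reaches_of_act_eq hε hη e hm, F.reaches_of_act_eq hη hε e.symm hm⟩

theorem not_pairConst_rankOne (hε : ε ∈ M) (h : IsRankOne ε a) :
    ¬ PairConst A o (A w (pair (.inl o) (.inr a) * ε)) := by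
  intro hc
  -- The pair at `a` prolongs the transversal to the lower row, whereas upper pairs cut it off.
  have h1 := F.act_rankOne_of_reaches hε (twoPairs_self_mem (.inl a) (.inr o))
    (h.reaches_iff.2 h.dom)
  rw [twoPairs_refl_left, hc, F.act_rankOne_upper hε (twoPairs_self_mem _ _)] at h1
  exact F.sep_w h1.symm

theorem act_rankZero_upper (hε : ε ∈ M)
    (hm : twoPairs (.inl s) (.inl t) (.inl i) (.inl j) ∈ motzkin n) :
    A (A u (discrete * ε)) (twoPairs (.inl s) (.inl t) (.inl i) (.inl j)) = A u discrete := by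
  rw [F.mul _ _ (F.discrete_mul_mem hε) _ (F.motzkin_le hm), mul_assoc, discrete_mul_mul_twoPairs]

theorem upperConst_rankZero (hε : ε ∈ M) : UpperConst A (A u (discrete * ε)) :=
  ⟨_, fun _ _ _ _ hm => F.act_rankZero_upper hε hm⟩

theorem pairConst_rankZero (hε : ε ∈ M) : PairConst A o (A u (discrete * ε)) := fun a => by
  rw [F.act_rankZero_upper hε (twoPairs_self_mem _ _),
    F.mul _ _ (F.discrete_mul_mem hε) _ (F.motzkin_le (pair_mem _ _)), mul_assoc,
    discrete_mul_mul_pair]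

theorem ker_of_act_eq (hε : ε ∈ M) (h : IsProjection ε) (hη : η ∈ M) (h' : IsProjection η)
    (e : A u (discrete * ε) = A u (discrete * η)) (hij : ε.Ker i j) : η.Ker i j := by
  have key : ∀ i j, i < j → ε.Ker i j → η.Ker i j := by
    intro i j hlt hij
    by_contra hn
    have hm := F.motzkin_le (rankZero_right_mem F.zero F.one hlt)
    have h1 := F.mul u _ (F.discrete_mul_mem hε) _ hm
    rw [e, F.mul u _ (F.discrete_mul_mem hη) _ hm, mul_assoc, mul_assoc,
      discrete_mul_mul_of_ker h hij, discrete_mul_mul_of_not_ker h' hn] at h1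
    exact F.sep_u h1.symm
  rcases lt_trichotomy i j with hlt | rfl | hlt
  exacts [key i j hlt hij, Ker.refl _ _, (key j i hlt hij.symm).symm]

theorem eq_of_rankZero (hε : ε ∈ M) (h : IsProjection ε) (hD : ∀ i, ¬ ε.Dom i) (hη : η ∈ M)
    (h' : IsProjection η) (hD' : ∀ i, ¬ η.Dom i)
    (e : A u (discrete * ε) = A u (discrete * η)) : ε = η :=
  h.eq_of_ker_dom h' (fun _ _ => ⟨F.ker_of_act_eq hε h hη h' e, F.ker_of_act_eq hη h' hε h e.symm⟩)
    fun i => iff_of_false (hD i) (hD' i)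

theorem act_extra {β : PartitionMonoid n} (hm : β ∈ motzkin n) (hβ : ∀ r, ∃ q, Inv β q r) :
    A z β = z := by
  rcases F.extra with rfl | rfl
  · rw [F.mul _ _ (F.motzkin_le (pair_mem _ _)) _ (F.motzkin_le hm),
      mul_eq_left_of_inv (fun p q r => by simp [inv_pair]) hβ]
  · rw [F.mul _ _ (F.motzkin_le discrete_mem) _ (F.motzkin_le hm),
      mul_eq_left_of_inv (fun p q r => by simp [inv_discrete]) hβ]

theorem act_extra_upper (hm : twoPairs (.inl s) (.inl t) (.inl i) (.inl j) ∈ motzkin n) :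
    A z (twoPairs (.inl s) (.inl t) (.inl i) (.inl j)) = z :=
  F.act_extra hm fun r => ⟨fun _ => True, by simp [inv_twoPairs]⟩

theorem upperConst_extra : UpperConst A z := ⟨_, fun _ _ _ _ hm => F.act_extra_upper hm⟩

theorem pairConst_extra : PairConst A o z := fun a => by
  rw [F.act_extra_upper (twoPairs_self_mem _ _),
    F.act_extra (pair_mem _ _) fun r => ⟨fun _ => r o, by simp [inv_pair]⟩]

/-- An upper pairing fixes `z` but moves the rank-zero point to the image of `u` under `discrete`,
which `z` was chosen to avoid. -/
theorem extra_ne_rankZero (hε : ε ∈ M) : z ≠ A u (discrete * ε) := fun e => by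
  have h1 := F.act_extra_upper (twoPairs_self_mem (.inl o) (.inl o))
  nth_rewrite 1 [e] at h1
  rw [F.act_rankZero_upper hε (twoPairs_self_mem _ _)] at h1
  exact F.extra_ne h1.symm

theorem eq_of_isPoint {p q : Option (PartitionMonoid n)} {y : X}
    (hp : IsPoint A o o' x w u z M p y) (hq : IsPoint A o o' x w u z M q y) : p = q := by
  generalize hy : y = y' at hq
  cases hp with
  | rankTwo ε a b hε h =>
    have hc := F.not_upperConst_rankTwo hε h
    rw [hy] at hc
    cases hq with
    | rankTwo η c d hη h' => rw [F.eq_of_rankTwo hε h hη h' hy]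
    | rankOne η c hη h' => exact absurd (F.upperConst_rankOne hη) hc
    | rankZero η hη h' hD => exact absurd (F.upperConst_rankZero hη) hc
    | extra => exact absurd F.upperConst_extra hc
  | rankOne ε a hε h =>
    have hc := F.not_pairConst_rankOne hε h
    have hu : UpperConst A (A w (pair (.inl o) (.inr a) * ε)) := F.upperConst_rankOne hε
    rw [hy] at hc hu
    cases hq with
    | rankTwo η c d hη h' => exact absurd hu (F.not_upperConst_rankTwo hη h')
    | rankOne η c hη h' => rw [F.eq_of_rankOne hε h hη h' hy]
    | rankZero η hη h' hD => exact absurd (F.pairConst_rankZero hη) hc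
    | extra => exact absurd F.pairConst_extra hc
  | rankZero ε hε h hD =>
    have hu : UpperConst A (A u (discrete * ε)) := F.upperConst_rankZero hε
    have hc := F.pairConst_rankZero hε
    rw [hy] at hc hu
    cases hq with
    | rankTwo η c d hη h' => exact absurd hu (F.not_upperConst_rankTwo hη h')
    | rankOne η c hη h' => exact absurd hc (F.not_pairConst_rankOne hη h')
    | rankZero η hη h' hD' => rw [F.eq_of_rankZero hε h hD hη h' hD' hy]
    | extra => exact absurd hy.symm (F.extra_ne_rankZero hε)
  | extra =>
    have hu := F.upperConst_extra
    have hc := F.pairConst_extra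
    rw [hy] at hc hu
    cases hq with
    | rankTwo η c d hη h' => exact absurd hu (F.not_upperConst_rankTwo hη h')
    | rankOne η c hη h' => exact absurd hc (F.not_pairConst_rankOne hη h')
    | rankZero η hη h' hD' => exact absurd hy (F.extra_ne_rankZero hη)
    | extra => rfl

theorem exists_injective :
    ∃ f : Option (lowRankProjections M) → X, Function.Injective f := by
  have h : ∀ p : Option (lowRankProjections M), ∃ y,
      IsPoint A o o' x w u z M (p.map Subtype.val) y := by
    rintro (_ | ⟨ε, hε⟩)
    · exact ⟨z, .extra⟩
    · exact exists_isPoint A o o' x w u z ε hε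
  -- A projection may have several points, one for each choice of representatives `a`, `b`. Any
  -- selection is injective, since a point determines its index.
  choose f hf using h
  refine ⟨f, fun p q e => ?_⟩
  have hp := hf p
  rw [e] at hp
  exact Option.map_injective Subtype.val_injective (F.eq_of_isPoint hp (hf q))

end IsFrame

end

/-! ### From a faithful action to the bound. -/

theorem motzkin_le {M : Submonoid (PartitionMonoid n)}
    (hM : M = ⊤ ∨ M = partialBrauer n ∨ M = planar n ∨ M = motzkin n) : motzkin n ≤ M := by
  rcases hM with rfl | rfl | rfl | rfl
  exacts [le_top, inf_le_right, inf_le_left, le_rfl]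

open Classical in
theorem card_le_of_faithful (hn : 2 ≤ n) {M : Submonoid (PartitionMonoid n)}
    (hM : motzkin n ≤ M) {X : Type*} (μ : SemigroupRightAction M X) (hμ : μ.Faithful) :
    ((1 + (lowRankProjections M).ncard : ℕ) : ℕ∞) ≤ ENat.card X := by
  -- The action is extended to all partitions to avoid carrying membership proofs; the value outside
  -- `M` plays no role.
  let A : X → PartitionMonoid n → X := fun x α => if h : α ∈ M then μ.act x ⟨α, h⟩ else x
  have hmul : ∀ x, ∀ α ∈ M, ∀ β ∈ M, A (A x α) β = A x (α * β) := by
    intro x α hα β hβ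
    simp only [A, hα, hβ, M.mul_mem hα hβ, dif_pos, μ.act_act]
    rfl
  have sep : ∀ {α β}, α ∈ motzkin n → β ∈ motzkin n → α ≠ β → ∃ x, A x α ≠ A x β := by
    intro α β hα hβ hne
    by_contra! h
    refine hne (congrArg Subtype.val (hμ ⟨α, hM hα⟩ ⟨β, hM hβ⟩ fun x => ?_))
    have := h x
    simpa only [A, hM hα, hM hβ, dif_pos] using this
  let o : Fin n := ⟨0, by omega⟩
  let o' : Fin n := ⟨1, by omega⟩
  have hoo : o ≠ o' := by simp [o, o']
  obtain ⟨x, hx⟩ := sep (pair_mem (.inl o) (.inl o')) discrete_mem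
    (pair_ne_discrete (by simpa using hoo))
  obtain ⟨w, hw⟩ := sep (pair_mem (.inl o) (.inr o)) discrete_mem (pair_ne_discrete (by simp))
  obtain ⟨u, hu⟩ := sep (pair_mem (.inr o) (.inr o')) discrete_mem
    (pair_ne_discrete (by simpa using hoo))
  obtain ⟨z, hz, hzu⟩ : ∃ z, (z = A x (pair (.inl o) (.inl o')) ∨ z = A x discrete) ∧
      z ≠ A u discrete := by
    -- The two images of `x` differ, so at least one of them is not the image of `u`.
    by_cases h : A x discrete = A u discrete
    · exact ⟨_, .inl rfl, fun h' => hx (h'.trans h.symm)⟩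
    · exact ⟨_, .inr rfl, h⟩
  obtain ⟨f, hf⟩ := IsFrame.exists_injective (A := A) (M := M) (o := o) (o' := o')
    ⟨rfl, rfl, hM, hmul, hx, hw, hu, hz, hzu⟩
  have h1 := ENat.card_le_card_of_injective hf
  rwa [ENat.card_eq_coe_natCard, Finite.card_option, add_comm] at h1

end PartitionMonoid

/-- A homomorphism into the monoid of self-maps of `X`, composed from left to right, is a right
action. -/
def SemigroupRightAction.ofHom {S : Type*} [Semigroup S] {X : Type*}
    (φ : S →ₙ* (Function.End X)ᵐᵒᵖ) : SemigroupRightAction S X where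
  act x a := (φ a).unop x
  act_act x a b := by rw [map_mul]; rfl

/-- A finite monoid embeds in the monoid of self-maps of a finite set, by right multiplication. -/
theorem exists_embedding_end (S : Type*) [Monoid S] [Finite S] :
    ∃ d : ℕ, 1 ≤ d ∧ ∃ φ : S →ₙ* (Function.End (Fin d))ᵐᵒᵖ, Function.Injective φ := by
  let e := Finite.equivFin S
  refine ⟨Nat.card S, Nat.card_pos, ⟨fun a => .op fun i => e (e.symm i * a), fun a b => ?_⟩,
    fun a b h => ?_⟩
  · apply MulOpposite.unop_injective
    funext i
    change e (e.symm i * (a * b)) = e (e.symm (e (e.symm i * a)) * b)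
    rw [e.symm_apply_apply, mul_assoc]
  · have h1 := congrFun (MulOpposite.op_injective h) (e 1)
    simpa using h1

theorem proposition4p5 (n : ℕ) (hn : 2 ≤ n) (M : Submonoid (PartitionMonoid n))
    (hM : M = ⊤ ∨ M = PartitionMonoid.partialBrauer n ∨ M = PartitionMonoid.planar n ∨
      M = PartitionMonoid.motzkin n) :
    1 + (PartitionMonoid.lowRankProjections M).ncard ≤ minTransformationDegree M ∧
    ∀ (X : Type*) (μ : SemigroupRightAction M X), μ.Faithful →
      ((1 + (PartitionMonoid.lowRankProjections M).ncard : ℕ) : ℕ∞) ≤ ENat.card X := by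
  -- Some embedding has to exist: the infimum of an empty set of naturals is `0`, and the lower
  -- bound would fail.
  refine ⟨le_csInf (exists_embedding_end M) ?_, fun X μ hμ =>
    PartitionMonoid.card_le_of_faithful hn (PartitionMonoid.motzkin_le hM) μ hμ⟩
  rintro d ⟨-, φ, hφ⟩
  have h := PartitionMonoid.card_le_of_faithful hn (PartitionMonoid.motzkin_le hM)
    (SemigroupRightAction.ofHom φ) fun a b hab =>
      hφ (MulOpposite.unop_injective (funext hab))
  rw [ENat.card_eq_coe_natCard, Nat.card_fin] at h
  exact Nat.cast_le.1 h
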